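/- Let $T$ be the rooted binary tree, with vertex set $v(T)$ (the finite binary words, the root being the empty word and the children of $u$ being $u0$ and $u1$), and let $\ell^2(T)=\ell^2(v(T))$. Let $T_0=v(T)\cup K$ be the compact space of all finite and infinite binary words, in which the vertices are isolated points and an infinite word $x=x_0x_1\dots$ has as basic neighbourhoods the sets of all finite and infinite words beginning with $x_0\dots x_{n-1}$. Its boundary $K=T_0\setminus v(T)$, the space of infinite words, is homeomorphic to the ternary Cantor set. Let $C(T_0)$ act on $\ell^2(T)$ by pointwise multiplication, let $S$ be the tree shift, $$(Sf)(v)=\begin{cases} f(\mathrm{par}(v)), & v\neq \text{root},\\ 0, & v=\text{root},\end{cases}$$ where $\mathrm{par}(v)$ is the parent of $v$, and put $L=\tfrac1{\sqrt2}S$. Let $A$ be the $C^*$-algebra on $\ell^2(T)$ generated by $S$ (equivalently, by $L$) and $C(T_0)$, let $C^*(L)$ be the $C^*$-algebra generated by $L$, and let $C^*(V)$ be the Toeplitz algebra, generated by the unilateral shift $V$ on $\ell^2(\mathbb Z_+)$. Then $A$ contains the ideal $\mathcal K=\mathcal K(\ell^2(T))$ of compact operators, and there are $*$-isomorphisms $$A/\mathcal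 K\;\cong\; C^*(L)\otimes C(K),\qquad C^*(L)\cong C^*(V),\qquad A/\mathcal K\;\cong\; C^*(V)\otimes C(K).$$ Here, for a unital $C^*$-algebra $B$, $B\otimes C(K)$ is the $C^*$-tensor product, i.e. the completion of the algebraic tensor product in its unique $C^*$-norm $\bigl\|\sum_i b_i\otimes f_i\bigr\|=\sup_{x\in K}\bigl\|\sum_i f_i(x)b_i\bigr\|$. -/

import Mathlib

open scoped TensorProduct ENNReal

noncomputable section

namespace TreeShift

/-! ### Operators on `ℓ²(ι)` -/

/-- The Hilbert space `ℓ²(ι)` of square-summable complex functions on `ι`. -/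
abbrev Ell2 (ι : Type) : Type := lp (fun _ : ι => ℂ) 2

/-- The `C*`-algebra of bounded operators on `ℓ²(ι)`. -/
abbrev BdOp (ι : Type) : Type := Ell2 ι →L[ℂ] Ell2 ι

/-- The values of the shifted function: `f (par v)` if `v` has a parent, and `0` at a root. -/
def shiftFun {ι : Type} (par : ι → Option ι) (f : ι → ℂ) (v : ι) : ℂ :=
  (par v).elim 0 f

theorem sum_norm_sq_le {ι : Type} (f : Ell2 ι) (s : Finset ι) :
    ∑ u ∈ s, ‖f u‖ ^ 2 ≤ ‖f‖ ^ 2 := by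
  have h := lp.sum_rpow_le_norm_rpow (p := 2) (by norm_num) f s
  simpa using h

theorem mem_of_sum_le {ι : Type} {g : ι → ℂ} {C : ℝ}
    (h : ∀ s : Finset ι, ∑ v ∈ s, ‖g v‖ ^ 2 ≤ C) : Memℓp g 2 :=
  memℓp_gen' (C := C) (by simpa using h)

theorem norm_le_of_sum_le {ι : Type} {g : Ell2 ι} {C : ℝ} (hC : 0 ≤ C)
    (h : ∀ s : Finset ι, ∑ v ∈ s, ‖g v‖ ^ 2 ≤ C ^ 2) : ‖g‖ ≤ C :=
  lp.norm_le_of_forall_sum_le (p := 2) (by norm_num) hC (by simpa using h)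

theorem shiftFun_sum_le {ι : Type} (par : ι → Option ι) (N : ℕ)
    (hN : ∀ (u : ι) (s : Finset ι), (∀ v ∈ s, par v = some u) → s.card ≤ N)
    (f : Ell2 ι) (s : Finset ι) :
    ∑ v ∈ s, ‖shiftFun par f v‖ ^ 2 ≤ N * ‖f‖ ^ 2 := by
  classical
  have h1 : ∑ v ∈ s, ‖shiftFun par f v‖ ^ 2
      = ∑ o ∈ s.image par, (s.filter (fun v => par v = o)).card • ‖o.elim 0 f‖ ^ 2 :=
    Finset.sum_comp (fun o : Option ι => ‖o.elim 0 (f : ι → ℂ)‖ ^ 2) par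
  have h2 : ∀ o ∈ s.image par,
      (s.filter (fun v => par v = o)).card • ‖o.elim 0 (f : ι → ℂ)‖ ^ 2
        ≤ N * ‖o.elim 0 (f : ι → ℂ)‖ ^ 2 := by
    intro o _
    rw [nsmul_eq_mul]
    cases o with
    | none => simp
    | some u =>
      have : (s.filter (fun v => par v = some u)).card ≤ N :=
        hN u _ (by intro v hv; exact (Finset.mem_filter.1 hv).2)
      gcongr
  have h3 : ∑ o ∈ s.image par, ‖o.elim 0 (f : ι → ℂ)‖ ^ 2
      ≤ ∑ o ∈ (Finset.eraseNone (s.image par)).insertNone, ‖o.elim 0 (f : ι → ℂ)‖ ^ 2 := by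
    refine Finset.sum_le_sum_of_subset_of_nonneg ?_ (fun _ _ _ => by positivity)
    rw [Finset.insertNone_eraseNone]
    exact Finset.subset_insert _ _
  rw [Finset.sum_insertNone] at h3
  have h4 := sum_norm_sq_le f (Finset.eraseNone (s.image par))
  have h5 : ∑ o ∈ s.image par, ‖o.elim 0 (f : ι → ℂ)‖ ^ 2 ≤ ‖f‖ ^ 2 := by
    refine h3.trans ?_
    simpa using h4
  calc _ ≤ ∑ o ∈ s.image par, N * ‖o.elim 0 (f : ι → ℂ)‖ ^ 2 := h1.trans_le (Finset.sum_le_sum h2)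
    _ = N * ∑ o ∈ s.image par, ‖o.elim 0 (f : ι → ℂ)‖ ^ 2 := by rw [Finset.mul_sum]
    _ ≤ N * ‖f‖ ^ 2 := by gcongr

/-- The shift operator `(S f)(v) = f (par v)`, and `(S f)(v) = 0` when `v` has no parent, of a
forest whose vertices all have at most `N` children. -/
def shiftOp {ι : Type} (par : ι → Option ι) (N : ℕ)
    (hN : ∀ (u : ι) (s : Finset ι), (∀ v ∈ s, par v = some u) → s.card ≤ N) : BdOp ι :=
  LinearMap.mkContinuous
    { toFun := fun f => ⟨shiftFun par f, mem_of_sum_le (shiftFun_sum_le par N hN f)⟩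
      map_add' := by
        intro f g
        ext v
        change shiftFun par (⇑(f + g)) v = shiftFun par f v + shiftFun par g v
        unfold shiftFun
        cases par v with
        | none => exact (add_zero 0).symm
        | some u => rfl
      map_smul' := by
        intro c f
        ext v
        change shiftFun par (⇑(c • f)) v = c • shiftFun par f v
        unfold shiftFun
        cases par v <;> simp }
    (√(N : ℝ))
    (by
      intro f
      refine norm_le_of_sum_le (by positivity) (fun s => ?_)
      rw [mul_pow, Real.sq_sqrt (Nat.cast_nonneg N)]
      exact shiftFun_sum_le par N hN f s)

theorem mulFun_sum_le {ι : Type} (m : ι → ℂ) (C : ℝ) (hm : ∀ v, ‖m v‖ ≤ C)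
    (f : Ell2 ι) (s : Finset ι) : ∑ v ∈ s, ‖m v * f v‖ ^ 2 ≤ C ^ 2 * ‖f‖ ^ 2 :=
  calc ∑ v ∈ s, ‖m v * f v‖ ^ 2 ≤ ∑ v ∈ s, C ^ 2 * ‖f v‖ ^ 2 := by
        refine Finset.sum_le_sum (fun v _ => ?_)
        rw [norm_mul, mul_pow]
        have := hm v
        gcongr
    _ = C ^ 2 * ∑ v ∈ s, ‖f v‖ ^ 2 := by rw [Finset.mul_sum]
    _ ≤ C ^ 2 * ‖f‖ ^ 2 := by
        have := sum_norm_sq_le f s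
        gcongr

/-- Pointwise multiplication on `ℓ²(ι)` by a function bounded by `C`. -/
def mulOp {ι : Type} (m : ι → ℂ) (C : ℝ) (hC : 0 ≤ C) (hm : ∀ v, ‖m v‖ ≤ C) : BdOp ι :=
  LinearMap.mkContinuous
    { toFun := fun f => ⟨fun v => m v * f v, mem_of_sum_le (mulFun_sum_le m C hm f)⟩
      map_add' := by
        intro f g
        ext v
        exact mul_add (m v) (f v) (g v)
      map_smul' := by
        intro c f
        ext v
        exact mul_left_comm (m v) c (f v) }
    C
    (by
      intro f
      refine norm_le_of_sum_le (by positivity) (fun s => ?_)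
      rw [mul_pow]
      exact mulFun_sum_le m C hm f s)

/-! ### The binary tree, its shift, and the unilateral shift -/

/-- The vertices of the standard rooted binary tree `T`: finite binary words. The root is the
empty word and the children of `u` are `u ++ [false]` and `u ++ [true]`. -/
abbrev Vertex : Type := List Bool

/-- The parent of a vertex of the binary tree: delete the last letter. The root has none. -/
def parent (v : Vertex) : Option Vertex := if v = [] then none else some v.dropLast

theorem parent_eq_some_iff (u v : Vertex) :
    parent v = some u ↔ v = u ++ [false] ∨ v = u ++ [true] := by
  unfold parent
  constructor
  · intro h
    split_ifs at h with hv
    have h2 := List.dropLast_append_getLast hv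
    rw [Option.some.inj h] at h2
    cases hb : v.getLast hv
    · left; rw [← h2, hb]
    · right; rw [← h2, hb]
  · rintro (rfl | rfl) <;> simp

theorem parent_fiber (u : Vertex) (s : Finset Vertex) (h : ∀ v ∈ s, parent v = some u) :
    s.card ≤ 2 := by
  have hs : s ⊆ {u ++ [false], u ++ [true]} := by
    intro v hv
    have := (parent_eq_some_iff u v).1 (h v hv)
    simpa using this
  exact (Finset.card_le_card hs).trans (Finset.card_le_two)

/-- The shift operator `S` of the binary tree. -/
def S : BdOp Vertex := shiftOp parent 2 parent_fiber

/-- The rescaled shift `L = S / √2`. -/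
def L : BdOp Vertex := ((√2 : ℝ) : ℂ)⁻¹ • S

/-- The predecessor of a natural number; `0` has none. -/
def predNat : ℕ → Option ℕ
  | 0 => none
  | n + 1 => some n

theorem predNat_fiber (u : ℕ) (s : Finset ℕ) (h : ∀ v ∈ s, predNat v = some u) :
    s.card ≤ 1 := by
  refine Finset.card_le_one.2 (fun a ha b hb => ?_)
  have h1 := h a ha
  have h2 := h b hb
  cases a <;> cases b <;> simp_all [predNat]

/-- The unilateral shift `V` on `ℓ²(ℕ)`: `V e_n = e_{n+1}`. -/
def V : BdOp ℕ := shiftOp predNat 1 predNat_fiber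

/-! ### The space `T₀ = v(T) ∪ K` -/

/-- The compact space `T₀ = v(T) ∪ K` of finite and infinite binary words. A word is coded by the
sequence of its letters, padded with `none` after its end if it is finite; the topology is that of
the product of discrete spaces. So vertices are isolated points, and an infinite word `x` has as
basic neighbourhoods the sets of all finite and infinite words which start with `x 0, …, x (n - 1)`.
-/
def T0 : Type := {x : ℕ → Option Bool // ∀ n, x n = none → x (n + 1) = none}

instance : TopologicalSpace (Option Bool) := ⊥

instance : DiscreteTopology (Option Bool) := ⟨rfl⟩

instance : TopologicalSpace T0 :=
  inferInstanceAs (TopologicalSpace {x : ℕ → Option Bool // ∀ n, x n = none → x (n + 1) = none})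

instance : T2Space T0 :=
  inferInstanceAs (T2Space {x : ℕ → Option Bool // ∀ n, x n = none → x (n + 1) = none})

instance : CompactSpace T0 := by
  have : IsClosed {x : ℕ → Option Bool | ∀ n, x n = none → x (n + 1) = none} := ?_
  · exact isCompact_iff_compactSpace.1 this.isCompact
  rw [Set.ofPred_forall]
  refine isClosed_iInter (fun n => ?_)
  have hcont : Continuous fun x : ℕ → Option Bool => (x n, x (n + 1)) := by fun_prop
  exact (isClosed_discrete {p : Option Bool × Option Bool | p.1 = none → p.2 = none}).preimage hcont

/-- The inclusion `v(T) ⊆ T₀`. -/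
def vertex (u : Vertex) : T0 := ⟨fun n => u[n]?, fun n h => by
  rw [List.getElem?_eq_none_iff] at h ⊢
  omega⟩

/-- The boundary `K = T₀ \ v(T)`, with the subspace topology. -/
def K : Type := {x : T0 // x ∉ Set.range vertex}

instance : TopologicalSpace K := inferInstanceAs (TopologicalSpace {x : T0 // x ∉ Set.range vertex})

theorem mem_range_vertex_iff (x : T0) : x ∈ Set.range vertex ↔ ∃ n, x.1 n = none := by
  constructor
  · rintro ⟨u, rfl⟩
    exact ⟨u.length, by simp [vertex]⟩
  · intro h
    classical
    have hmin := fun m => Nat.find_min (m := m) h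
    have hn := Nat.find_spec h
    set n := Nat.find h
    have hge : ∀ m, n ≤ m → x.1 m = none := by
      intro m hm
      induction m, hm using Nat.le_induction with
      | base => exact hn
      | succ m _ ih => exact x.2 m ih
    refine ⟨List.ofFn (fun i : Fin n => (x.1 i).getD false), Subtype.ext (funext fun m => ?_)⟩
    change (List.ofFn (fun i : Fin n => (x.1 i).getD false))[m]? = x.1 m
    rw [List.getElem?_ofFn]
    split_ifs with hm
    · have := hmin m hm
      cases hx : x.1 m with
      | none => exact absurd hx this
      | some b => simp
    · exact (hge m (not_lt.1 hm)).symm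

/-- `K` is the space of infinite binary words. -/
def boundaryEquiv : (ℕ → Bool) ≃ₜ K where
  toFun x := ⟨⟨fun n => some (x n), fun n h => absurd h (Option.some_ne_none _)⟩, by
    intro hx
    obtain ⟨n, hn⟩ := (mem_range_vertex_iff _).1 hx
    exact Option.some_ne_none _ hn⟩
  invFun x n := (x.1.1 n).getD false
  left_inv x := by simp
  right_inv x := by
    refine Subtype.ext (Subtype.ext (funext fun n => ?_))
    have h := x.2
    rw [mem_range_vertex_iff, not_exists] at h
    have hn := h n
    change some ((x.1.1 n).getD false) = x.1.1 n
    cases hx : x.1.1 n with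
    | none => exact absurd hx hn
    | some b => simp
  continuous_toFun := by
    refine Continuous.subtype_mk (Continuous.subtype_mk ?_ _) _
    exact continuous_pi fun n => (continuous_of_discreteTopology (f := some)).comp
      (continuous_apply n)
  continuous_invFun := by
    refine continuous_pi fun n => ?_
    exact (continuous_of_discreteTopology (f := fun o : Option Bool => o.getD false)).comp
      ((continuous_apply n).comp (continuous_subtype_val.comp continuous_subtype_val))

instance : CompactSpace K := boundaryEquiv.compactSpace

/-- `K` is the ternary Cantor set. -/
def boundaryHomeoCantorSet : K ≃ₜ cantorSet :=
  boundaryEquiv.symm.trans cantorSetHomeomorphNatToBool.symm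

/-! ### The algebras -/

/-- A continuous function on `T₀` acts on `ℓ²(T)` by pointwise multiplication. -/
def M (f : C(T0, ℂ)) : BdOp Vertex :=
  mulOp (fun v => f (vertex v)) ‖f‖ (norm_nonneg f) (fun v => f.norm_coe_le_norm (vertex v))

/-- The `C*`-algebra `A` generated by `S` and `C(T₀)` on `ℓ²(T)`. -/
def A : StarSubalgebra ℂ (BdOp Vertex) :=
  (StarAlgebra.adjoin ℂ (insert S (Set.range M))).topologicalClosure

/-- The `C*`-algebra generated by one bounded operator and the identity. -/
def CStarGen {ι : Type} (T : BdOp ι) : Type := StarAlgebra.elemental ℂ T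

instance {ι : Type} (T : BdOp ι) : CStarAlgebra (CStarGen T) :=
  haveI : IsClosed (StarAlgebra.elemental ℂ T : Set (BdOp ι)) := StarAlgebra.elemental.isClosed ℂ T
  inferInstanceAs (CStarAlgebra (StarAlgebra.elemental ℂ T))

/-- The `C*`-algebra `C*(L)` generated by `L` on `ℓ²(T)`; it is unital since `L* L = 1`. -/
abbrev CStarL : Type := CStarGen L

/-- The Toeplitz algebra `C*(V)` generated by `V` on `ℓ²(ℕ)`; it is unital since `V* V = 1`. -/
abbrev CStarV : Type := CStarGen V

/-! ### The quotient by the compact operators -/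

section Quotient

variable {H : Type} [NormedAddCommGroup H] [InnerProductSpace ℂ H] [CompleteSpace H]

theorem isCompactOperator_star {T : H →L[ℂ] H} (hT : IsCompactOperator T) :
    IsCompactOperator (star T : H →L[ℂ] H) := by
  refine (isCompactOperator_iff_isCompact_closure_image_ball
    ((star T : H →L[ℂ] H) : H →ₗ[ℂ] H) one_pos).2 ?_
  have hc : IsCompactOperator (T * star T : H →L[ℂ] H) := hT.comp_clm (star T)
  have htb : TotallyBounded ((T * star T : H →L[ℂ] H) '' Metric.ball 0 1) :=
    (hc.isCompact_closure_image_ball (𝕜₁ := ℂ) 1).totallyBounded.subset subset_closure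
  have key : TotallyBounded ((star T : H →L[ℂ] H) '' Metric.ball 0 1) := by
    rw [Metric.totallyBounded_iff]
    intro ε hε
    obtain ⟨t, hts, htf, ht⟩ := Metric.finite_approx_of_totallyBounded htb (ε ^ 2 / 2)
      (by positivity)
    obtain ⟨r, hrs, hrf, rfl⟩ : ∃ r ⊆ Metric.ball (0 : H) 1, r.Finite ∧
        (T * star T : H →L[ℂ] H) '' r = t := by
      obtain ⟨r, hr1, hr2⟩ := (Set.subset_image_iff (f := (T * star T : H →L[ℂ] H))).1 hts
      obtain ⟨q, hq1, hq2⟩ := Set.SurjOn.exists_bijOn_subset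
        (f := (T * star T : H →L[ℂ] H)) (s := r) (t := t) hr2.ge
      exact ⟨q, hq1.trans hr1, Set.Finite.of_finite_image (by rw [hq2.image_eq]; exact htf)
        hq2.injOn, hq2.image_eq⟩
    refine ⟨(star T : H →L[ℂ] H) '' r, hrf.image _, ?_⟩
    rintro _ ⟨x, hx, rfl⟩
    have := ht ⟨x, hx, rfl⟩
    simp only [Set.mem_iUnion, Set.mem_image, exists_prop, exists_exists_and_eq_and,
      Metric.mem_ball] at this ⊢
    obtain ⟨y, hy, hxy⟩ := this
    refine ⟨y, hy, ?_⟩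
    rw [dist_eq_norm, ← map_sub] at hxy ⊢
    have hz : ‖x - y‖ ≤ 2 := by
      have h1 : ‖x‖ < 1 := by simpa using hx
      have h2 : ‖y‖ < 1 := by simpa using hrs hy
      linarith [norm_sub_le x y]
    set z := x - y
    have hsq : ‖(star T : H →L[ℂ] H) z‖ ^ 2 ≤ ‖(T * star T : H →L[ℂ] H) z‖ * ‖z‖ := by
      rw [← inner_self_eq_norm_sq (𝕜 := ℂ), ContinuousLinearMap.star_eq_adjoint,
        ContinuousLinearMap.adjoint_inner_right]
      exact (RCLike.re_le_norm _).trans (norm_inner_le_norm _ _)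
    have hlt : ‖(star T : H →L[ℂ] H) z‖ ^ 2 < ε ^ 2 := by
      have hn := norm_nonneg ((T * star T : H →L[ℂ] H) z)
      nlinarith
    exact lt_of_pow_lt_pow_left₀ 2 hε.le hlt
  exact key.closure.isCompact_of_isClosed isClosed_closure

/-- The ideal of compact operators in a `*`-algebra of bounded operators. -/
def compactIdeal (B : StarSubalgebra ℂ (H →L[ℂ] H)) : Ideal B where
  carrier := {a | IsCompactOperator (a : H →L[ℂ] H)}
  add_mem' := fun ha hb => IsCompactOperator.add ha hb
  zero_mem' := isCompactOperator_zero
  smul_mem' := fun c _ ha => IsCompactOperator.clm_comp ha (c : H →L[ℂ] H)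

instance (B : StarSubalgebra ℂ (H →L[ℂ] H)) : (compactIdeal B).IsTwoSided where
  mul_mem_of_left := fun {a} b ha =>
    IsCompactOperator.comp_clm (f := (a : H →L[ℂ] H)) ha (b : H →L[ℂ] H)

theorem star_mem_compactIdeal (B : StarSubalgebra ℂ (H →L[ℂ] H)) {a : B}
    (ha : a ∈ compactIdeal B) : star a ∈ compactIdeal B :=
  isCompactOperator_star (T := (a : H →L[ℂ] H)) ha

/-- The involution of the quotient by the compact operators: `(a + 𝒦)* = a* + 𝒦`. -/
instance (B : StarSubalgebra ℂ (H →L[ℂ] H)) : StarRing (B ⧸ compactIdeal B) where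
  star := Quotient.map' star (by
    intro a b h
    rw [Submodule.quotientRel_def] at h ⊢
    rw [← star_sub]
    exact star_mem_compactIdeal B h)
  star_involutive := by
    intro x
    obtain ⟨a, rfl⟩ := Ideal.Quotient.mk_surjective x
    exact congrArg (Ideal.Quotient.mk (compactIdeal B)) (star_star a)
  star_mul := by
    intro x y
    obtain ⟨a, rfl⟩ := Ideal.Quotient.mk_surjective x
    obtain ⟨b, rfl⟩ := Ideal.Quotient.mk_surjective y
    exact congrArg (Ideal.Quotient.mk (compactIdeal B)) (star_mul a b)
  star_add := by
    intro x y
    obtain ⟨a, rfl⟩ := Ideal.Quotient.mk_surjective x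
    obtain ⟨b, rfl⟩ := Ideal.Quotient.mk_surjective y
    exact congrArg (Ideal.Quotient.mk (compactIdeal B)) (star_add a b)

end Quotient

/-! ### The tensor product of a `C*`-algebra with `C(X)` -/

section Tensor

variable (B : Type) [CStarAlgebra B] (X : Type) [TopologicalSpace X] [CompactSpace X]

/-- The algebraic tensor product `B ⊙ C(X)` mapped to the `C*`-algebra of continuous functions
`X → B`, by `b ⊗ f ↦ (x ↦ f x • b)`. -/
def tensorToFun : B ⊗[ℂ] C(X, ℂ) →ₗ[ℂ] C(X, B) :=
  TensorProduct.lift (LinearMap.mk₂ ℂ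
    (fun (b : B) (f : C(X, ℂ)) => (⟨fun x => f x • b, by fun_prop⟩ : C(X, B)))
    (fun b b' f => by ext x; exact smul_add (f x) b b')
    (fun c b f => by ext x; exact smul_comm (f x) c b)
    (fun b f g => by ext x; exact add_smul (f x) (g x) b)
    (fun c b f => by ext x; exact mul_smul c (f x) b))

@[simp]
theorem tensorToFun_tmul (b : B) (f : C(X, ℂ)) (x : X) :
    tensorToFun B X (b ⊗ₜ f) x = f x • b := rfl

/-- `B ⊙ C(X)` embeds into the continuous functions. -/
theorem tensorToFun_injective : Function.Injective (tensorToFun B X) := by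
  classical
  let β := Module.Basis.ofVectorSpace ℂ B
  let e := TensorProduct.equivFinsuppOfBasisLeft (N := C(X, ℂ)) β
  have key : ∀ (t : B ⊗[ℂ] C(X, ℂ)) (x : X) (i : _),
      β.repr (tensorToFun B X t x) i = e t i x := by
    intro t x i
    induction t with
    | zero => simp
    | tmul b f => simp [e, mul_comm]
    | add s t hs ht => simp [hs, ht]
  intro s t h
  apply e.injective
  ext i x
  rw [← key, ← key, h]

/-- The image of `B ⊙ C(X)`, as a `*`-algebra of continuous functions. -/
def algTensor : StarSubalgebra ℂ C(X, B) where
  carrier := Set.range (tensorToFun B X)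
  mul_mem' := by
    rintro _ _ ⟨s, rfl⟩ ⟨t, rfl⟩
    refine ⟨s * t, ?_⟩
    induction s with
    | zero => simp
    | add s s' hs hs' => simp [add_mul, hs, hs']
    | tmul b f =>
      induction t with
      | zero => simp
      | add t t' ht ht' => simp [mul_add, ht, ht']
      | tmul c g =>
        ext x
        simp [Algebra.TensorProduct.tmul_mul_tmul, mul_smul, smul_comm (f x) (g x)]
  add_mem' := by
    rintro _ _ ⟨s, rfl⟩ ⟨t, rfl⟩
    exact ⟨s + t, map_add _ s t⟩
  algebraMap_mem' := by
    intro c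
    refine ⟨1 ⊗ₜ (algebraMap ℂ C(X, ℂ) c), ?_⟩
    ext x
    simp [Algebra.algebraMap_eq_smul_one]
  star_mem' := by
    rintro _ ⟨t, rfl⟩
    refine ⟨star t, ?_⟩
    induction t with
    | zero => simp
    | add s t hs ht => simp [hs, ht]
    | tmul b f =>
      ext x
      simp [star_smul]

/-- The `C*`-algebra `B ⊗ C(X)`: the completion of the algebraic tensor product `B ⊙ C(X)` in
its `C*`-norm `‖∑ bᵢ ⊗ fᵢ‖ = sup_x ‖∑ fᵢ(x) bᵢ‖`, realized as the closure of the image of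
`B ⊙ C(X)` in `C(X, B)` for the uniform norm. (The `C*`-norm is unique as `C(X)` is commutative,
hence nuclear.) -/
def CStarTensor : StarSubalgebra ℂ C(X, B) := (algTensor B X).topologicalClosure

end Tensor

end TreeShift

end

/-!
The heart of the matter is that, up to compact operators, an element of `A` is block diagonal with
respect to the subtrees at a deep level of the tree, with blocks in `C*(L)` that depend continuously
on the point of the boundary below the subtree.

*Compact operators.* The projections onto single vertices lie in `C(T₀)`, and with the powers of `S`
they produce all matrix units, hence all compact operators (`mem_A_of_isCompactOperator`).

*The algebra `C*(L)`.* `L` is an isometry, and each unit vector `w` of `ker L*` gives an isometry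
`e_k ↦ L ^ k w` of `ℓ²(ℕ)` into `ℓ²(T)`, called a chain, which intertwines `V` with `L` and `V*`
with `L*`. So an element of `C*(L)` acts in the same way on all chains. Since `L` is pure, i.e. the
chains span a dense subspace, this action is an injective, hence isometric, homomorphism
`C*(L) → C*(V)` (`toeplitzEquiv`).

*The symbol.* For a continuous `g : K → C*(L)` let `sample n g` be the block diagonal operator whose
block in the subtree of a word `u` of length `n` is the value of `g` at a boundary point below `u`.
Subtree projections commute with `C*(L)` modulo compact operators, so `sample n` is a contractive,
`*`-preserving linear map, multiplicative modulo compact operators. The operator `a` has the symbol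
`g` if `a - sample n g` tends to `0` modulo compact operators. Two estimates make the symbol an
isometry of `A / 𝒦`.

* `dist (a, 𝒦) ≤ ‖g‖`, because block sums are contractive (`HasSymbol.exists_norm_sub_le`).
* `‖g‖ ≤ ‖a - k‖` for all compact `k` (`HasSymbol.norm_le`): a chain which starts deep in the subtree
  of `u` stays there, so that it detects the norm of the block at `u`, while it is nearly annihilated
  by `k`.

Thus the pairs of an operator and its symbol form a closed `*`-algebra `symbolGraph`. Its first
projection is an isometry with range `A`, because the generators have symbols. Its second projection
has a closed and dense range, hence is onto `C(K, C*(L))`, and its kernel consists of the compact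
operators. Finally, `C*(L) ⊗ C(K)` is all of `C(K, C*(L))`, by approximation with locally constant
functions.
-/

namespace TreeShift

open InnerProductSpace Filter Topology

/-! ### Multiplication operators and shifts in coordinates -/

section Coordinates

variable {ι : Type}

/-- The vector `e_v` of the standard orthonormal basis of `ℓ²(ι)`. -/
noncomputable def basisVec [DecidableEq ι] (v : ι) : Ell2 ι := lp.single 2 v (1 : ℂ)

theorem basisVec_apply [DecidableEq ι] (v u : ι) : basisVec v u = if u = v then (1 : ℂ) else 0 := by
  simp [basisVec, Pi.single_apply]

theorem inner_basisVec_left [DecidableEq ι] (v : ι) (f : Ell2 ι) :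
    inner ℂ (basisVec v) f = f v := by
  simp [basisVec, lp.inner_single_left]

theorem norm_basisVec [DecidableEq ι] (v : ι) : ‖basisVec v‖ = 1 := by
  simp [basisVec, lp.norm_single]

theorem clm_ext_basisVec [DecidableEq ι] {F : Type*} [NormedAddCommGroup F] [NormedSpace ℂ F]
    {a b : Ell2 ι →L[ℂ] F} (h : ∀ v, a (basisVec v) = b (basisVec v)) : a = b := by
  refine lp.ext_continuousLinearMap (by simp) fun v => ?_
  ext
  exact h v

theorem shiftOp_apply (par : ι → Option ι) (N hN) (f : Ell2 ι) (v : ι) :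
    shiftOp par N hN f v = (par v).elim 0 f := rfl

end Coordinates

theorem M_apply (f : C(T0, ℂ)) (g : Ell2 Vertex) (v : Vertex) : M f g v = f (vertex v) * g v := rfl

theorem M_one : M 1 = 1 := by
  ext g v
  simp [M_apply]

theorem M_mul (f g : C(T0, ℂ)) : M (f * g) = M f * M g := by
  ext h v
  simp [M_apply, mul_assoc]

theorem M_add (f g : C(T0, ℂ)) : M (f + g) = M f + M g := by
  ext h v
  simp [M_apply, add_mul]

theorem M_smul (c : ℂ) (f : C(T0, ℂ)) : M (c • f) = c • M f := by
  ext h v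
  simp [M_apply, mul_assoc]

theorem M_sum {α : Type*} (s : Finset α) (f : α → C(T0, ℂ)) :
    M (∑ i ∈ s, f i) = ∑ i ∈ s, M (f i) :=
  map_sum (AddMonoidHom.mk' M M_add) f s

theorem M_sub (f g : C(T0, ℂ)) : M (f - g) = M f - M g :=
  map_sub (AddMonoidHom.mk' M M_add) f g

theorem star_M (f : C(T0, ℂ)) : star (M f) = M (star f) := by
  rw [ContinuousLinearMap.star_eq_adjoint, eq_comm, ContinuousLinearMap.eq_adjoint_iff]
  intro x y
  rw [lp.inner_eq_tsum, lp.inner_eq_tsum]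
  refine tsum_congr fun v => ?_
  simp [M_apply, mul_left_comm, mul_comm]

theorem norm_M_le {f : C(T0, ℂ)} {C : ℝ} (hC : 0 ≤ C) (h : ∀ v, ‖f (vertex v)‖ ≤ C) :
    ‖M f‖ ≤ C := by
  have : M f = mulOp (fun v => f (vertex v)) C hC h := by
    ext g v
    rfl
  rw [this]
  exact LinearMap.mkContinuous_norm_le _ hC _

theorem S_apply (f : Ell2 Vertex) (v : Vertex) : S f v = (parent v).elim 0 f := rfl

theorem S_apply_nil (f : Ell2 Vertex) : S f [] = 0 := rfl

theorem parent_append (u : Vertex) (b : Bool) : parent (u ++ [b]) = some u := by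
  simp [parent]

theorem S_apply_append (f : Ell2 Vertex) (u : Vertex) (b : Bool) : S f (u ++ [b]) = f u := by
  rw [S_apply, parent_append]
  rfl

theorem S_basisVec (u : Vertex) :
    S (basisVec u) = basisVec (u ++ [false]) + basisVec (u ++ [true]) := by
  ext v
  rw [lp.coeFn_add, Pi.add_apply]
  rcases List.eq_nil_or_concat v with rfl | ⟨w, b, rfl⟩
  · simp [S_apply_nil, basisVec_apply]
  · rw [List.concat_eq_append, S_apply_append]
    simp only [basisVec_apply, List.append_singleton_inj]
    cases b <;> simp

theorem star_S_apply (f : Ell2 Vertex) (u : Vertex) :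
    star S f u = f (u ++ [false]) + f (u ++ [true]) := by
  rw [← inner_basisVec_left, ContinuousLinearMap.star_eq_adjoint,
    ContinuousLinearMap.adjoint_inner_right, S_basisVec, inner_add_left, inner_basisVec_left,
    inner_basisVec_left]

theorem L_apply (f : Ell2 Vertex) : L f = ((√2 : ℝ) : ℂ)⁻¹ • S f := rfl

theorem star_L_apply (f : Ell2 Vertex) : star L f = ((√2 : ℝ) : ℂ)⁻¹ • star S f := by
  simp [L, star_smul]

theorem sqrt_two_inv_mul_self : ((√2 : ℝ) : ℂ)⁻¹ * ((√2 : ℝ) : ℂ)⁻¹ = 2⁻¹ := by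
  rw [← mul_inv, ← Complex.ofReal_mul, Real.mul_self_sqrt (by norm_num)]
  simp

theorem star_L_mul_L : star L * L = 1 := by
  ext f u
  rw [mul_apply_eq_comp, star_L_apply, L_apply, map_smul, smul_smul,
    sqrt_two_inv_mul_self, lp.coeFn_smul, Pi.smul_apply, star_S_apply, S_apply_append,
    S_apply_append]
  simp only [smul_eq_mul, one_apply_eq_self]
  ring

theorem S_eq_smul_L : S = ((√2 : ℝ) : ℂ) • L := by
  rw [L, smul_smul, mul_inv_cancel₀ (by simp), one_smul]

theorem V_apply_succ (f : Ell2 ℕ) (n : ℕ) : V f (n + 1) = f n := rfl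

theorem V_basisVec (n : ℕ) : V (basisVec n) = basisVec (n + 1) := by
  ext m
  cases m with
  | zero => simp [V, shiftOp_apply, predNat, basisVec_apply]
  | succ m => simp [V_apply_succ, basisVec_apply]

theorem star_V_apply (f : Ell2 ℕ) (n : ℕ) : star V f n = f (n + 1) := by
  rw [← inner_basisVec_left, ContinuousLinearMap.star_eq_adjoint,
    ContinuousLinearMap.adjoint_inner_right, V_basisVec, inner_basisVec_left]

theorem star_V_basisVec_zero : star V (basisVec 0) = 0 := by
  ext n
  simp [star_V_apply, basisVec_apply]

theorem star_V_basisVec_succ (n : ℕ) : star V (basisVec (n + 1)) = basisVec n := by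
  ext m
  simp [star_V_apply, basisVec_apply]

/-! ### Cylinders in `T₀` -/

theorem continuous_letter (i : ℕ) : Continuous fun t : T0 => t.1 i :=
  (continuous_apply i).comp continuous_subtype_val

/-- The cylinder of the words which begin with `u 0, …, u (n - 1)`. -/
def cyl {n : ℕ} (u : Fin n → Bool) : Set T0 := {t | ∀ i : Fin n, t.1 i = some (u i)}

theorem isClopen_cyl {n : ℕ} (u : Fin n → Bool) : IsClopen (cyl u) := by
  have : cyl u = ⋂ i : Fin n, (fun t : T0 => t.1 i) ⁻¹' {some (u i)} := by
    ext t
    simp [cyl]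
  rw [this]
  exact isClopen_iInter_of_finite fun i => (isClopen_discrete _).preimage (continuous_letter i)

theorem isClopen_singleton_vertex (v : Vertex) : IsClopen {vertex v} := by
  refine ⟨isClosed_singleton, ?_⟩
  have : {vertex v} = ⋂ i : Fin (v.length + 1), (fun t : T0 => t.1 i) ⁻¹' {v[(i : ℕ)]?} := by
    ext t
    simp only [Set.mem_singleton_iff, Set.mem_iInter, Set.mem_preimage]
    refine ⟨fun h i => h ▸ rfl, fun h => Subtype.ext (funext fun m => ?_)⟩
    have key : ∀ m, v.length ≤ m → t.1 m = none := by
      intro m hm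
      induction m, hm using Nat.le_induction with
      | base => simpa using h ⟨v.length, by omega⟩
      | succ m _ ih => exact t.2 m ih
    change t.1 m = v[m]?
    rcases lt_or_ge m v.length with hm | hm
    · exact h ⟨m, by omega⟩
    · rw [key m hm, List.getElem?_eq_none hm]
  rw [this]
  exact isOpen_iInter_of_finite fun i => (isOpen_discrete _).preimage (continuous_letter i)

theorem vertex_injective : Function.Injective vertex := fun _ _ h =>
  List.ext_getElem? fun i => congrFun (congrArg Subtype.val h) i

/-- The indicator of a clopen set, as a continuous function. -/
noncomputable def clopenInd {X : Type} [TopologicalSpace X] (s : Set X) (hs : IsClopen s) :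
    C(X, ℂ) :=
  ⟨s.indicator 1, (IsClopen.continuous_indicator hs continuous_one)⟩

open Classical in
theorem clopenInd_apply {X : Type} [TopologicalSpace X] (s : Set X) (hs : IsClopen s) (x : X) :
    clopenInd s hs x = if x ∈ s then 1 else 0 := by
  simp [clopenInd, Set.indicator_apply]

/-! ### Compact operators on `ℓ²(T)` -/

theorem isCompactOperator_rankOne {H : Type*} [NormedAddCommGroup H] [InnerProductSpace ℂ H]
    (x y : H) : IsCompactOperator (rankOne ℂ x y) := by
  rw [rankOne_def']
  exact (isCompactOperator_of_locallyCompactSpace_rng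
    (ContinuousLinearMap.toSpanSingleton ℂ x)).comp_clm (innerSL ℂ y)

theorem M_singleton_vertex (v : Vertex) :
    M (clopenInd {vertex v} (isClopen_singleton_vertex v)) =
      rankOne ℂ (basisVec v) (basisVec v) := by
  ext g w
  rw [M_apply, clopenInd_apply, rankOne_apply, inner_basisVec_left, lp.coeFn_smul, Pi.smul_apply,
    basisVec_apply]
  by_cases h : w = v
  · simp [h]
  · simp [h, vertex_injective.eq_iff]

theorem isClopen_short (n : ℕ) : IsClopen {t : T0 | ∃ i : Fin n, t.1 i = none} := by
  have : {t : T0 | ∃ i : Fin n, t.1 i = none} =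
      ⋃ i : Fin n, (fun t : T0 => t.1 i) ⁻¹' {none} := by
    ext t
    simp
  rw [this]
  exact isClopen_iUnion_of_finite fun i => (isClopen_discrete _).preimage (continuous_letter i)

/-- The indicator of the set of words of length less than `n`. -/
noncomputable def short (n : ℕ) : C(T0, ℂ) := clopenInd _ (isClopen_short n)

theorem short_apply (n : ℕ) (t : T0) :
    short n t = if ∃ i : Fin n, t.1 i = none then 1 else 0 := by
  rw [short, clopenInd_apply]
  congr

theorem short_vertex (n : ℕ) (v : Vertex) : short n (vertex v) = if v.length < n then 1 else 0 := by
  classical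
  have : (∃ i : Fin n, (vertex v).1 i = none) ↔ v.length < n := by
    simp only [vertex, List.getElem?_eq_none_iff]
    exact ⟨fun ⟨i, hi⟩ => hi.trans_lt i.2, fun h => ⟨⟨_, h⟩, le_rfl⟩⟩
  simp only [short_apply, this]

/-- The orthogonal projection of `ℓ²(T)` onto the functions supported on words of length less
than `n`. -/
noncomputable def shortProj (n : ℕ) : BdOp Vertex := M (short n)

theorem shortProj_apply (n : ℕ) (f : Ell2 Vertex) (v : Vertex) :
    shortProj n f v = if v.length < n then f v else 0 := by
  rw [shortProj, M_apply, short_vertex]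
  split_ifs <;> simp

theorem star_shortProj (n : ℕ) : star (shortProj n) = shortProj n := by
  classical
  rw [shortProj, star_M]
  congr 1
  ext t
  rw [ContinuousMap.star_apply, short_apply]
  split_ifs <;> simp

theorem norm_shortProj_le (n : ℕ) : ‖shortProj n‖ ≤ 1 := by
  refine norm_M_le zero_le_one fun v => ?_
  rw [short_vertex]
  split_ifs <;> simp

theorem norm_one_sub_shortProj_le (n : ℕ) : ‖1 - shortProj n‖ ≤ 1 := by
  rw [← M_one, shortProj, ← M_sub]
  refine norm_M_le zero_le_one fun v => ?_
  rw [ContinuousMap.sub_apply, short_vertex]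
  split_ifs <;> simp

theorem shortProj_eq_sum (n : ℕ) :
    shortProj n = ∑ v ∈ (List.finite_length_lt Bool n).toFinset,
      rankOne ℂ (basisVec v) (basisVec v) := by
  refine clm_ext_basisVec fun w => ?_
  have h : shortProj n (basisVec w) = if w.length < n then basisVec w else 0 := by
    ext v
    rw [shortProj_apply]
    by_cases hv : v = w
    · subst hv
      split_ifs <;> rfl
    · split_ifs <;> simp [basisVec_apply, hv]
  rw [h, sum_apply]
  simp [inner_basisVec_left, basisVec_apply]

theorem isCompactOperator_shortProj (n : ℕ) : IsCompactOperator (shortProj n) := by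
  rw [shortProj_eq_sum]
  exact Submodule.sum_mem (compactOperator (RingHom.id ℂ) (Ell2 Vertex) (Ell2 Vertex))
    fun v _ => isCompactOperator_rankOne _ _

/-- The projections `shortProj n` converge strongly to the identity. -/
theorem exists_shortProj_near (f : Ell2 Vertex) {ε : ℝ} (hε : 0 < ε) :
    ∃ N, ∀ n, N ≤ n → ‖f - shortProj n f‖ < ε := by
  have h := lp.hasSum_single (p := 2) (by simp) f
  obtain ⟨s, hs⟩ := (Metric.tendsto_nhds.1 h ε hε).exists
  set z := ∑ i ∈ s, lp.single (E := fun _ : Vertex => ℂ) 2 i (f i) with hz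
  refine ⟨s.sup List.length + 1, fun n hn => ?_⟩
  have hfix : shortProj n z = z := by
    ext v
    rw [shortProj_apply]
    split_ifs with hv
    · rfl
    · rw [hz, lp.coeFn_sum, Finset.sum_apply]
      refine (Finset.sum_eq_zero fun i hi => lp.single_apply_ne 2 i _ ?_).symm
      rintro rfl
      have := Finset.le_sup (f := List.length) hi
      omega
  have : f - shortProj n f = (1 - shortProj n) (f - z) := by
    rw [map_sub, sub_apply, sub_apply, hfix]
    simp
  rw [this]
  calc _ ≤ ‖1 - shortProj n‖ * ‖f - z‖ := ContinuousLinearMap.le_opNorm _ _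
    _ ≤ 1 * ‖f - z‖ := by gcongr; exact norm_one_sub_shortProj_le n
    _ < ε := by rwa [one_mul, norm_sub_rev, ← dist_eq_norm]

theorem exists_norm_sub_shortProj_mul_le {k : BdOp Vertex} (hk : IsCompactOperator k) {ε : ℝ}
    (hε : 0 < ε) : ∃ N, ∀ n, N ≤ n → ‖k - shortProj n * k‖ ≤ ε := by
  have htb : TotallyBounded (k '' Metric.closedBall 0 1) :=
    (hk.isCompact_closure_image_closedBall (𝕜₁ := ℂ) 1).totallyBounded.subset subset_closure
  obtain ⟨t, htf, ht⟩ := Metric.totallyBounded_iff.1 htb (ε / 2) (by positivity)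
  choose N hN using fun y => exists_shortProj_near y (half_pos hε)
  refine ⟨htf.toFinset.sup N, fun n hn => ?_⟩
  refine ContinuousLinearMap.opNorm_le_of_unit_norm hε.le fun x hx => ?_
  have hx' : k x ∈ k '' Metric.closedBall 0 1 := ⟨x, by simp [hx], rfl⟩
  obtain ⟨y, hy, hxy⟩ := Set.mem_iUnion₂.1 (ht hx')
  have h1 := hN y n ((Finset.le_sup (f := N) (htf.mem_toFinset.2 hy)).trans hn)
  have h2 : (k - shortProj n * k) x =
      (1 - shortProj n) (k x - y) + (y - shortProj n y) := by
    simp only [map_sub, sub_apply, mul_apply_eq_comp, one_apply_eq_self]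
    abel
  rw [h2]
  have h3 : ‖(1 - shortProj n) (k x - y)‖ ≤ 1 * ‖k x - y‖ :=
    ContinuousLinearMap.le_of_opNorm_le _ (norm_one_sub_shortProj_le n) _
  rw [Metric.mem_ball, dist_eq_norm] at hxy
  linarith [norm_add_le ((1 - shortProj n) (k x - y)) (y - shortProj n y)]

theorem exists_norm_sub_mul_shortProj_le {k : BdOp Vertex} (hk : IsCompactOperator k) {ε : ℝ}
    (hε : 0 < ε) : ∃ N, ∀ n, N ≤ n → ‖k - k * shortProj n‖ ≤ ε := by
  obtain ⟨N, hN⟩ := exists_norm_sub_shortProj_mul_le (isCompactOperator_star hk) hε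
  refine ⟨N, fun n hn => ?_⟩
  have := hN n hn
  rwa [← norm_star, star_sub, star_mul, star_star, star_shortProj] at this

/-! ### The algebra `A` contains the compact operators -/

theorem isClosed_A : IsClosed (A : Set (BdOp Vertex)) := StarSubalgebra.isClosed_topologicalClosure _

theorem adjoin_le_A : StarAlgebra.adjoin ℂ (insert S (Set.range M)) ≤ A :=
  StarSubalgebra.le_topologicalClosure _

theorem S_mem_A : S ∈ A := adjoin_le_A (StarAlgebra.subset_adjoin ℂ _ (Set.mem_insert _ _))

theorem M_mem_A (f : C(T0, ℂ)) : M f ∈ A :=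
  adjoin_le_A (StarAlgebra.subset_adjoin ℂ _ (Set.mem_insert_of_mem _ ⟨f, rfl⟩))

theorem L_mem_A : L ∈ A := A.smul_mem S_mem_A _

theorem rankOne_root_mem_A (u : Vertex) : rankOne ℂ (basisVec u) (basisVec []) ∈ A := by
  induction u using List.reverseRecOn with
  | nil => exact M_singleton_vertex [] ▸ M_mem_A _
  | append_singleton u b ih =>
    -- the matrix unit at `u b` is `p S` times the one at `u`, with `p` the projection at `u b`
    have h := A.mul_mem (M_mem_A (clopenInd _ (isClopen_singleton_vertex (u ++ [b]))))
      (A.mul_mem S_mem_A ih)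
    rw [M_singleton_vertex, ContinuousLinearMap.mul_def, ContinuousLinearMap.mul_def,
      comp_rankOne, comp_rankOne, rankOne_apply, inner_basisVec_left, S_apply_append,
      basisVec_apply, if_pos rfl, one_smul] at h
    exact h

theorem rankOne_mem_A (u v : Vertex) : rankOne ℂ (basisVec u) (basisVec v) ∈ A := by
  have h := A.mul_mem (rankOne_root_mem_A u) (star_mem (s := A) (rankOne_root_mem_A v))
  rw [ContinuousLinearMap.star_eq_adjoint, adjoint_rankOne, ContinuousLinearMap.mul_def,
    rankOne_comp_rankOne, inner_basisVec_left, basisVec_apply, if_pos rfl, one_smul] at h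
  exact h

theorem mem_A_of_isCompactOperator {k : BdOp Vertex} (hk : IsCompactOperator k) : k ∈ A := by
  have hmem (n : ℕ) : shortProj n * k * shortProj n ∈ A := by
    rw [shortProj_eq_sum, Finset.sum_mul, Finset.sum_mul_sum]
    refine A.sum_mem fun u _ => A.sum_mem fun v _ => ?_
    rw [ContinuousLinearMap.mul_def, ContinuousLinearMap.mul_def, ContinuousLinearMap.comp_assoc,
      comp_rankOne, rankOne_comp_rankOne]
    exact A.smul_mem (rankOne_mem_A u v) _
  refine isClosed_A.closure_subset (Metric.mem_closure_iff.2 fun ε hε => ?_)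
  obtain ⟨N₁, h₁⟩ := exists_norm_sub_shortProj_mul_le hk (show 0 < ε / 3 by positivity)
  obtain ⟨N₂, h₂⟩ := exists_norm_sub_mul_shortProj_le hk (show 0 < ε / 3 by positivity)
  set n := max N₁ N₂
  refine ⟨_, hmem n, ?_⟩
  have h : k - shortProj n * k * shortProj n =
      (k - shortProj n * k) + shortProj n * (k - k * shortProj n) := by noncomm_ring
  have h' : ‖shortProj n * (k - k * shortProj n)‖ ≤ 1 * (ε / 3) :=
    (norm_mul_le _ _).trans (mul_le_mul (norm_shortProj_le n) (h₂ n (le_max_right _ _))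
      (norm_nonneg _) zero_le_one)
  rw [dist_eq_norm, h]
  linarith [norm_add_le (k - shortProj n * k) (shortProj n * (k - k * shortProj n)),
    h₁ n (le_max_left _ _)]

/-! ### Wandering vectors and the isomorphism of `C*(L)` with the Toeplitz algebra -/

/-- A unit vector of `ker L*`, the wandering subspace of the isometry `L`. -/
structure Wandering (w : Ell2 Vertex) : Prop where
  norm_eq : ‖w‖ = 1
  star_L : star L w = 0

theorem star_L_L (f : Ell2 Vertex) : star L (L f) = f := by
  rw [← mul_apply_eq_comp, star_L_mul_L, one_apply_eq_self]

theorem inner_L_L (f g : Ell2 Vertex) : inner ℂ (L f) (L g) = inner ℂ f g := by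
  rw [← ContinuousLinearMap.adjoint_inner_right, ← ContinuousLinearMap.star_eq_adjoint, star_L_L]

theorem inner_L_pow_L_pow (f g : Ell2 Vertex) (i j : ℕ) :
    inner ℂ ((L ^ i) f) ((L ^ (i + j)) g) = inner ℂ f ((L ^ j) g) := by
  induction i with
  | zero => simp
  | succ i ih =>
    rw [pow_succ', Nat.succ_add, pow_succ', mul_apply_eq_comp, mul_apply_eq_comp, inner_L_L, ih]

theorem Wandering.orthonormal {w : Ell2 Vertex} (hw : Wandering w) :
    Orthonormal ℂ fun k : ℕ => (L ^ k) w := by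
  have h (i j : ℕ) : inner ℂ ((L ^ i) w) ((L ^ (i + (j + 1))) w) = 0 := by
    rw [inner_L_pow_L_pow, pow_succ', mul_apply_eq_comp,
      ← ContinuousLinearMap.adjoint_inner_left, ← ContinuousLinearMap.star_eq_adjoint, hw.star_L,
      inner_zero_left]
  refine ⟨fun k => ?_, fun i j hij => ?_⟩
  · have h2 := congrArg RCLike.re (inner_L_pow_L_pow w w k 0)
    rw [add_zero, pow_zero, one_apply_eq_self, inner_self_eq_norm_sq, inner_self_eq_norm_sq,
      hw.norm_eq, one_pow] at h2
    exact (pow_eq_one_iff_of_nonneg (norm_nonneg _) two_ne_zero).1 h2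
  · change inner ℂ ((L ^ i) w) ((L ^ j) w) = 0
    rcases lt_or_gt_of_ne hij with h' | h'
    · obtain ⟨d, rfl⟩ := Nat.exists_eq_add_of_lt h'
      exact h i d
    · obtain ⟨d, rfl⟩ := Nat.exists_eq_add_of_lt h'
      exact inner_eq_zero_symm.1 (h j d)

/-- The isometry `e_k ↦ L ^ k w` of `ℓ²(ℕ)` into `ℓ²(T)` determined by a wandering vector `w`. -/
noncomputable def Wandering.chain {w : Ell2 Vertex} (hw : Wandering w) :
    Ell2 ℕ →L[ℂ] Ell2 Vertex :=
  hw.orthonormal.orthogonalFamily.linearIsometry.toContinuousLinearMap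

namespace Wandering

variable {w : Ell2 Vertex} (hw : Wandering w)

theorem norm_chain_apply (f : Ell2 ℕ) : ‖hw.chain f‖ = ‖f‖ :=
  hw.orthonormal.orthogonalFamily.linearIsometry.norm_map f

theorem chain_basisVec (k : ℕ) : hw.chain (basisVec k) = (L ^ k) w := by
  change hw.orthonormal.orthogonalFamily.linearIsometry (lp.single 2 k (1 : ℂ)) = _
  rw [OrthogonalFamily.linearIsometry_apply_single]
  simp

theorem norm_chain_le : ‖hw.chain‖ ≤ 1 :=
  ContinuousLinearMap.opNorm_le_bound _ zero_le_one fun f => by rw [hw.norm_chain_apply, one_mul]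

theorem adjoint_chain_comp_chain : hw.chain.adjoint ∘L hw.chain = 1 :=
  (ContinuousLinearMap.norm_map_iff_adjoint_comp_self _).1 hw.norm_chain_apply

theorem L_comp_chain : L ∘L hw.chain = hw.chain ∘L V := by
  refine clm_ext_basisVec fun k => ?_
  simp only [ContinuousLinearMap.comp_apply, chain_basisVec, V_basisVec, pow_succ',
    mul_apply_eq_comp]

theorem star_L_comp_chain : star L ∘L hw.chain = hw.chain ∘L star V := by
  refine clm_ext_basisVec fun k => ?_
  rw [ContinuousLinearMap.comp_apply, ContinuousLinearMap.comp_apply, chain_basisVec]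
  cases k with
  | zero => rw [pow_zero, one_apply_eq_self, hw.star_L, star_V_basisVec_zero, map_zero]
  | succ k =>
    rw [pow_succ', mul_apply_eq_comp, star_L_L, star_V_basisVec_succ, chain_basisVec]

end Wandering

theorem wandering_root : Wandering (basisVec []) where
  norm_eq := norm_basisVec _
  star_L := by
    ext u
    rw [star_L_apply, lp.coeFn_smul, Pi.smul_apply, star_S_apply]
    simp [basisVec_apply]

/-- The normalized difference of the basis vectors at the two children of `v`. Together with the
root vector, these form an orthonormal basis of `ker L*`. -/
noncomputable def siblingDiff (v : Vertex) : Ell2 Vertex :=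
  ((√2 : ℝ) : ℂ)⁻¹ • (basisVec (v ++ [false]) - basisVec (v ++ [true]))

theorem wandering_siblingDiff (v : Vertex) : Wandering (siblingDiff v) where
  norm_eq := by
    have h : ‖basisVec (v ++ [false]) - basisVec (v ++ [true])‖ ^ 2 = 2 := by
      rw [norm_sub_sq (𝕜 := ℂ), inner_basisVec_left, norm_basisVec, norm_basisVec, basisVec_apply,
        if_neg (by simp)]
      norm_num
    rw [siblingDiff, norm_smul, ← Real.sqrt_sq (norm_nonneg (_ - _)), h, norm_inv,
      Complex.norm_of_nonneg (Real.sqrt_nonneg 2), inv_mul_cancel₀ (by simp)]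
  star_L := by
    ext u
    rw [star_L_apply, lp.coeFn_smul, Pi.smul_apply, star_S_apply]
    simp only [siblingDiff, lp.coeFn_smul, lp.coeFn_sub, Pi.smul_apply, Pi.sub_apply,
      basisVec_apply, List.append_singleton_inj]
    simp

/-- The compression of an operator on `ℓ²(T)` to the chain `L ^ k e_∅`, transported to `ℓ²(ℕ)`. -/
noncomputable def rootCompression (b : BdOp Vertex) : BdOp ℕ :=
  wandering_root.chain.adjoint ∘L b ∘L wandering_root.chain

theorem rootCompression_eq {b : BdOp Vertex} {t : BdOp ℕ}
    (h : b ∘L wandering_root.chain = wandering_root.chain ∘L t) : rootCompression b = t := by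
  rw [rootCompression, h, ← ContinuousLinearMap.comp_assoc,
    Wandering.adjoint_chain_comp_chain]
  exact one_mul t

theorem star_rootCompression (b : BdOp Vertex) :
    rootCompression (star b) = star (rootCompression b) := by
  simp only [rootCompression, ContinuousLinearMap.star_eq_adjoint,
    ContinuousLinearMap.adjoint_comp, ContinuousLinearMap.adjoint_adjoint,
    ContinuousLinearMap.comp_assoc]

theorem continuous_rootCompression : Continuous rootCompression :=
  continuous_const.clm_comp (continuous_id.clm_comp continuous_const)

/-- The operators on `ℓ²(T)` which act in the same way on all the chains `L ^ k w`. -/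
noncomputable def chainUniform : StarSubalgebra ℂ (BdOp Vertex) where
  carrier := {b | ∀ (w : Ell2 Vertex) (hw : Wandering w),
    b ∘L hw.chain = hw.chain ∘L rootCompression b ∧
      star b ∘L hw.chain = hw.chain ∘L rootCompression (star b)}
  mul_mem' := by
    intro b c hb hc
    have key : ∀ {b c : BdOp Vertex},
        (∀ (w) (hw : Wandering w), b ∘L hw.chain = hw.chain ∘L rootCompression b) →
        (∀ (w) (hw : Wandering w), c ∘L hw.chain = hw.chain ∘L rootCompression c) →
        ∀ (w) (hw : Wandering w),
          (b * c) ∘L hw.chain = hw.chain ∘L rootCompression (b * c) := by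
      intro b c hb hc
      have h (w) (hw : Wandering w) :
          (b * c) ∘L hw.chain = hw.chain ∘L (rootCompression b * rootCompression c) := by
        rw [ContinuousLinearMap.mul_def, ContinuousLinearMap.comp_assoc, hc w hw,
          ← ContinuousLinearMap.comp_assoc, hb w hw, ContinuousLinearMap.mul_def,
          ContinuousLinearMap.comp_assoc]
      intro w hw
      rw [rootCompression_eq (h _ wandering_root), h]
    intro w hw
    refine ⟨key (fun w hw => (hb w hw).1) (fun w hw => (hc w hw).1) w hw, ?_⟩
    rw [star_mul]
    exact key (fun w hw => (hc w hw).2) (fun w hw => (hb w hw).2) w hw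
  add_mem' := by
    intro b c hb hc w hw
    simp only [star_add]
    have h (b c : BdOp Vertex) :
        rootCompression (b + c) = rootCompression b + rootCompression c := by
      simp [rootCompression]
    rw [ContinuousLinearMap.add_comp, ContinuousLinearMap.add_comp, h, h,
      ContinuousLinearMap.comp_add, ContinuousLinearMap.comp_add]
    exact ⟨congrArg₂ _ (hb w hw).1 (hc w hw).1, congrArg₂ _ (hb w hw).2 (hc w hw).2⟩
  algebraMap_mem' := by
    intro r
    have h (r : ℂ) (w) (hw : Wandering w) :
        algebraMap ℂ (BdOp Vertex) r ∘L hw.chain = hw.chain ∘L algebraMap ℂ (BdOp ℕ) r := by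
      ext f
      simp [Algebra.algebraMap_eq_smul_one]
    intro w hw
    rw [← algebraMap_star_comm, rootCompression_eq (h _ _ wandering_root),
      rootCompression_eq (h _ _ wandering_root)]
    exact ⟨h _ _ _, h _ _ _⟩
  star_mem' := by
    intro b hb w hw
    rw [star_star]
    exact (hb w hw).symm

theorem isClosed_chainUniform : IsClosed (chainUniform : Set (BdOp Vertex)) := by
  have : (chainUniform : Set (BdOp Vertex)) = ⋂ (w : Ell2 Vertex) (hw : Wandering w),
      {b | b ∘L hw.chain = hw.chain ∘L rootCompression b} ∩
        {b | star b ∘L hw.chain = hw.chain ∘L rootCompression (star b)} := by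
    ext b
    simp [chainUniform, Set.mem_iInter]
  rw [this]
  have hc := continuous_rootCompression
  refine isClosed_iInter fun w => isClosed_iInter fun hw => IsClosed.inter ?_ ?_
  · exact isClosed_eq (continuous_id.clm_comp continuous_const) (continuous_const.clm_comp hc)
  · exact isClosed_eq (continuous_star.clm_comp continuous_const)
      (continuous_const.clm_comp (hc.comp continuous_star))

theorem rootCompression_L : rootCompression L = V :=
  rootCompression_eq wandering_root.L_comp_chain

theorem elemental_L_le_chainUniform : StarAlgebra.elemental ℂ L ≤ chainUniform := by
  refine StarAlgebra.elemental.le_of_mem isClosed_chainUniform fun w hw => ?_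
  rw [star_rootCompression, rootCompression_L]
  exact ⟨hw.L_comp_chain, hw.star_L_comp_chain⟩

/-- The ranges of the chains span a dense subspace. -/
theorem eq_zero_of_comp_chain_eq_zero {b : BdOp Vertex}
    (h : ∀ (w) (hw : Wandering w), b ∘L hw.chain = 0) : b = 0 := by
  have h1 (w) (hw : Wandering w) (k : ℕ) : b ((L ^ k) w) = 0 := by
    rw [← hw.chain_basisVec, ← ContinuousLinearMap.comp_apply, h, zero_apply]
  -- induct on the word `u`: `e_{v0} + e_{v1}` is a multiple of `L e_v`, and `e_{v0} - e_{v1}` one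
  -- of a wandering vector
  have h2 (u : Vertex) : ∀ k : ℕ, b ((L ^ k) (basisVec u)) = 0 := by
    induction u using List.reverseRecOn with
    | nil => exact h1 _ wandering_root
    | append_singleton v c ih =>
      intro k
      have hd := h1 _ (wandering_siblingDiff v) k
      have hs := ih (k + 1)
      rw [pow_succ, mul_apply_eq_comp, L_apply, S_basisVec, map_smul, map_smul,
        smul_eq_zero_iff_right (by simp), map_add, map_add] at hs
      rw [siblingDiff, map_smul, map_smul, smul_eq_zero_iff_right (by simp), map_sub, map_sub,
        sub_eq_zero] at hd
      rw [← hd, ← two_smul ℂ, smul_eq_zero_iff_right two_ne_zero] at hs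
      cases c
      · exact hs
      · rw [← hd, hs]
  exact clm_ext_basisVec fun u => by simpa using h2 u 0

/-- The inclusion of the `C*`-algebra generated by an operator. -/
noncomputable def CStarGen.incl {ι : Type} (T : BdOp ι) : CStarGen T →⋆ₐ[ℂ] BdOp ι :=
  (StarAlgebra.elemental ℂ T).subtype

theorem CStarGen.incl_injective {ι : Type} (T : BdOp ι) : Function.Injective (incl T) :=
  Subtype.val_injective

theorem CStarGen.incl_mem {ι : Type} (T : BdOp ι) (b : CStarGen T) :
    incl T b ∈ StarAlgebra.elemental ℂ T := b.2

/-- The generator of the `C*`-algebra generated by an operator. -/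
noncomputable def CStarGen.gen {ι : Type} (T : BdOp ι) : CStarGen T :=
  (⟨T, StarAlgebra.elemental.self_mem ℂ T⟩ : StarAlgebra.elemental ℂ T)

/-- The `*`-homomorphism from `C*(L)` to operators on `ℓ²(ℕ)` given by the action on the chains. -/
noncomputable def chainHom : CStarL →⋆ₐ[ℂ] BdOp ℕ where
  toFun b := rootCompression (CStarGen.incl L b)
  map_one' := by
    rw [map_one]
    exact rootCompression_eq rfl
  map_mul' b c := by
    rw [map_mul]
    refine rootCompression_eq ?_
    have hb := (elemental_L_le_chainUniform (CStarGen.incl_mem L b) _ wandering_root).1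
    have hc := (elemental_L_le_chainUniform (CStarGen.incl_mem L c) _ wandering_root).1
    rw [ContinuousLinearMap.mul_def, ContinuousLinearMap.comp_assoc, hc,
      ← ContinuousLinearMap.comp_assoc, hb]
    rfl
  map_zero' := by simp [rootCompression]
  map_add' b c := by simp [rootCompression]
  commutes' r := by
    refine rootCompression_eq ?_
    rw [AlgHomClass.commutes]
    ext f
    simp [Algebra.algebraMap_eq_smul_one]
  map_star' b := by rw [map_star, star_rootCompression]

theorem comp_chain_eq (b : CStarL) {w : Ell2 Vertex} (hw : Wandering w) :
    CStarGen.incl L b ∘L hw.chain = hw.chain ∘L chainHom b :=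
  (elemental_L_le_chainUniform (CStarGen.incl_mem L b) w hw).1

theorem chainHom_injective : Function.Injective chainHom := by
  refine (injective_iff_map_eq_zero chainHom).2 fun b hb => CStarGen.incl_injective L ?_
  rw [map_zero]
  refine eq_zero_of_comp_chain_eq_zero fun w hw => ?_
  rw [comp_chain_eq, hb, ContinuousLinearMap.comp_zero]

theorem norm_chainHom (b : CStarL) : ‖chainHom b‖ = ‖b‖ :=
  NonUnitalStarAlgHom.norm_map chainHom chainHom_injective b

theorem range_chainHom : chainHom.range = StarAlgebra.elemental ℂ V := by
  have hL : chainHom (CStarGen.gen L) = V :=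
    rootCompression_L
  refine le_antisymm ?_ (StarAlgebra.elemental.le_of_mem ?_ ⟨_, hL⟩)
  · rintro _ ⟨b, rfl⟩
    refine StarAlgebra.elemental.induction_on ℂ b.2
      (P := fun u _ => rootCompression u ∈ StarAlgebra.elemental ℂ V) ?_ ?_ ?_ ?_ ?_ ?_
    · exact rootCompression_L ▸ StarAlgebra.elemental.self_mem ℂ V
    · rw [star_rootCompression, rootCompression_L]
      exact StarAlgebra.elemental.star_self_mem ℂ V
    · intro r
      have h := AlgHomClass.commutes chainHom r
      change rootCompression (algebraMap ℂ _ r) = _ at h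
      exact h ▸ algebraMap_mem _ r
    · intro u hu v hv hu' hv'
      have h := map_add chainHom (⟨u, hu⟩ : StarAlgebra.elemental ℂ L) ⟨v, hv⟩
      change rootCompression (u + v) = _ at h
      exact h ▸ add_mem hu' hv'
    · intro u hu v hv hu' hv'
      have h := map_mul chainHom (⟨u, hu⟩ : StarAlgebra.elemental ℂ L) ⟨v, hv⟩
      change rootCompression (u * v) = _ at h
      exact h ▸ mul_mem hu' hv'
    · intro s _ hs v hv
      exact (StarAlgebra.elemental.isClosed ℂ V).closure_subset
        (map_mem_closure continuous_rootCompression hv hs)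
  · exact (NonUnitalStarAlgHom.isometry chainHom chainHom_injective).isClosedEmbedding.isClosed_range

/-- The `*`-isomorphism between `C*(L)` and the Toeplitz algebra. -/
noncomputable def toeplitzEquiv : CStarL ≃⋆ₐ[ℂ] CStarV :=
  StarAlgEquiv.ofBijective
    (chainHom.codRestrict (StarAlgebra.elemental ℂ V) fun b => range_chainHom ▸ ⟨b, rfl⟩ :
      CStarL →⋆ₐ[ℂ] StarAlgebra.elemental ℂ V)
    ⟨fun b c h => chainHom_injective (congrArg Subtype.val h), fun t => by
      have ht : CStarGen.incl V t ∈ chainHom.range := range_chainHom ▸ CStarGen.incl_mem V t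
      obtain ⟨b, hb⟩ := ht
      exact ⟨b, Subtype.ext hb⟩⟩

/-! ### Uniform approximation by locally constant functions -/

/-- Uniform continuity on a compact space of sequences: a continuous function is nearly constant on
the sets of sequences with a given long prefix. -/
theorem exists_forall_dist_lt_of_prefix_eq {X D E : Type*} [TopologicalSpace X] [CompactSpace X]
    [TopologicalSpace D] [DiscreteTopology D] [PseudoMetricSpace E] {c : X → ℕ → D}
    (hc : IsInducing c) {f : X → E} (hf : Continuous f) {ε : ℝ} (hε : 0 < ε) :
    ∃ N, ∀ s t, (∀ i < N, c s i = c t i) → dist (f s) (f t) < ε := by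
  have hbasis (s : X) : ∃ n, ∀ t, (∀ i < n, c t i = c s i) → dist (f t) (f s) < ε / 2 := by
    have hU : f ⁻¹' Metric.ball (f s) (ε / 2) ∈ 𝓝 s :=
      hf.continuousAt.preimage_mem_nhds (Metric.ball_mem_nhds _ (half_pos hε))
    rw [hc.nhds_eq_comap] at hU
    obtain ⟨V, hV, hVU⟩ := mem_comap.1 hU
    obtain ⟨_, ⟨x, n, rfl⟩, hs, hsub⟩ :=
      (PiNat.isTopologicalBasis_cylinders fun _ : ℕ => D).mem_nhds_iff.1 hV
    refine ⟨n, fun t ht => hVU (hsub fun i hi => (ht i hi).trans (hs i hi))⟩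
  choose n hn using hbasis
  have hopen (s : X) : {t | ∀ i < n s, c t i = c s i} ∈ 𝓝 s := by
    refine IsOpen.mem_nhds ?_ fun _ _ => rfl
    have : {t | ∀ i < n s, c t i = c s i} = c ⁻¹' PiNat.cylinder (c s) (n s) := rfl
    rw [this]
    exact (PiNat.isOpen_cylinder (fun _ => D) _ _).preimage hc.continuous
  obtain ⟨F, -, hF⟩ := isCompact_univ.elim_nhds_subcover _ fun s _ => hopen s
  refine ⟨F.sup n, fun s t hst => ?_⟩
  obtain ⟨r, hr, hsr⟩ := Set.mem_iUnion₂.1 (hF (Set.mem_univ s))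
  have h1 := hn r s hsr
  have h2 := hn r t fun i hi =>
    (hst i (hi.trans_le (Finset.le_sup (f := n) hr))).symm.trans (hsr i hi)
  linarith [dist_triangle_right (f s) (f t) (f r)]

/-- The infinite word which continues `u` by zeros, a point of the boundary in the cylinder
of `u`. -/
noncomputable def basePoint {n : ℕ} (u : Fin n → Bool) : K :=
  boundaryEquiv fun i => if h : i < n then u ⟨i, h⟩ else false

theorem basePoint_mem_cyl {n : ℕ} (u : Fin n → Bool) : (basePoint u).1 ∈ cyl u := by
  intro i
  change some (if h : (i : ℕ) < n then u ⟨i, h⟩ else false) = some (u i)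
  rw [dif_pos i.2]

/-- The prefix of length `n` of an infinite word. -/
noncomputable def initialWord (n : ℕ) (x : K) : Fin n → Bool := fun i => boundaryEquiv.symm x i

theorem mem_cyl_initialWord (n : ℕ) (x : K) : x.1 ∈ cyl (initialWord n x) := by
  intro i
  obtain ⟨y, rfl⟩ := boundaryEquiv.surjective x
  rw [initialWord, Homeomorph.symm_apply_apply]
  rfl

theorem eq_of_mem_cyl {n : ℕ} {u u' : Fin n → Bool} {t : T0} (h : t ∈ cyl u) (h' : t ∈ cyl u') :
    u = u' :=
  funext fun i => Option.some_injective _ ((h i).symm.trans (h' i))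

theorem exists_dist_basePoint_lt {E : Type*} [PseudoMetricSpace E] {f : T0 → E}
    (hf : Continuous f) {ε : ℝ} (hε : 0 < ε) :
    ∃ N, ∀ n, N ≤ n → ∀ u : Fin n → Bool, ∀ t ∈ cyl u, dist (f t) (f (basePoint u).1) < ε := by
  have hc : IsInducing fun t : T0 => t.1 := ⟨rfl⟩
  obtain ⟨N, hN⟩ := exists_forall_dist_lt_of_prefix_eq hc hf hε
  refine ⟨N, fun n hn u t ht => hN _ _ fun i hi => ?_⟩
  exact (ht ⟨i, hi.trans_le hn⟩).trans (basePoint_mem_cyl u ⟨i, hi.trans_le hn⟩).symm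

theorem exists_dist_basePoint_initialWord_lt {E : Type*} [PseudoMetricSpace E] {g : K → E}
    (hg : Continuous g) {ε : ℝ} (hε : 0 < ε) :
    ∃ N, ∀ n, N ≤ n → ∀ x, dist (g x) (g (basePoint (initialWord n x))) < ε := by
  have hc : IsInducing fun x : K => x.1.1 :=
    IsInducing.comp (g := fun t : T0 => t.1) ⟨rfl⟩ (f := fun x : K => x.1) ⟨rfl⟩
  obtain ⟨N, hN⟩ := exists_forall_dist_lt_of_prefix_eq hc hg hε
  refine ⟨N, fun n hn x => hN _ _ fun i hi => ?_⟩
  exact (mem_cyl_initialWord n x ⟨i, hi.trans_le hn⟩).trans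
    (basePoint_mem_cyl _ ⟨i, hi.trans_le hn⟩).symm

/-! ### Subtree projections and block sums -/

/-- The indicator of the cylinder of `u`, as a continuous function on `T₀`. -/
noncomputable def cylInd {n : ℕ} (u : Fin n → Bool) : C(T0, ℂ) := clopenInd _ (isClopen_cyl u)

open Classical in
theorem cylInd_apply {n : ℕ} (u : Fin n → Bool) (t : T0) :
    cylInd u t = if t ∈ cyl u then 1 else 0 := clopenInd_apply _ _ _

theorem cylInd_mul_self {n : ℕ} (u : Fin n → Bool) : cylInd u * cylInd u = cylInd u := by
  ext t
  rw [ContinuousMap.mul_apply, cylInd_apply]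
  split_ifs <;> simp

theorem cylInd_mul_of_ne {n : ℕ} {u u' : Fin n → Bool} (h : u ≠ u') :
    cylInd u * cylInd u' = 0 := by
  ext t
  rw [ContinuousMap.mul_apply, cylInd_apply, cylInd_apply]
  split_ifs with h1 h2
  · exact absurd (eq_of_mem_cyl h1 h2) h
  all_goals simp

theorem star_cylInd {n : ℕ} (u : Fin n → Bool) : star (cylInd u) = cylInd u := by
  ext t
  rw [ContinuousMap.star_apply, cylInd_apply]
  split_ifs <;> simp

theorem sum_mul_cylInd_apply {n : ℕ} (c : (Fin n → Bool) → ℂ) {u : Fin n → Bool} {t : T0}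
    (h : t ∈ cyl u) : ∑ u', c u' * cylInd u' t = c u := by
  rw [Finset.sum_eq_single u]
  · rw [cylInd_apply, if_pos h, mul_one]
  · intro u' _ hu'
    rw [cylInd_apply, if_neg fun h' => hu' (eq_of_mem_cyl h' h), mul_zero]
  · simp

/-- A word of length at least `n` lies in a cylinder of level `n`. -/
theorem exists_mem_cyl {n : ℕ} {t : T0} (h : ¬ ∃ i : Fin n, t.1 i = none) :
    ∃ u : Fin n → Bool, t ∈ cyl u := by
  push Not at h
  choose u hu using fun i => Option.ne_none_iff_exists'.1 (h i)
  exact ⟨u, hu⟩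

theorem sum_cylInd (n : ℕ) : ∑ u : Fin n → Bool, cylInd u = 1 - short n := by
  ext t
  rw [ContinuousMap.sum_apply, ContinuousMap.sub_apply, ContinuousMap.one_apply, short_apply]
  split_ifs with h
  · rw [sub_self]
    refine Finset.sum_eq_zero fun u _ => ?_
    obtain ⟨i, hi⟩ := h
    rw [cylInd_apply, if_neg]
    intro hu
    rw [hu i] at hi
    exact Option.some_ne_none _ hi
  · obtain ⟨u, hu⟩ := exists_mem_cyl h
    rw [sub_zero, ← sum_mul_cylInd_apply (fun _ => 1) hu]
    simp

/-- The orthogonal projection of `ℓ²(T)` onto the functions supported on the subtree of the words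
beginning with `u`. -/
noncomputable def subtreeProj {n : ℕ} (u : Fin n → Bool) : BdOp Vertex := M (cylInd u)

theorem subtreeProj_mul_self {n : ℕ} (u : Fin n → Bool) :
    subtreeProj u * subtreeProj u = subtreeProj u := by
  rw [subtreeProj, ← M_mul, cylInd_mul_self]

theorem subtreeProj_mul_of_ne {n : ℕ} {u u' : Fin n → Bool} (h : u ≠ u') :
    subtreeProj u * subtreeProj u' = 0 := by
  rw [subtreeProj, subtreeProj, ← M_mul, cylInd_mul_of_ne h]
  ext f v
  simp [M_apply]

theorem star_subtreeProj {n : ℕ} (u : Fin n → Bool) : star (subtreeProj u) = subtreeProj u := by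
  rw [subtreeProj, star_M, star_cylInd]

theorem sum_subtreeProj (n : ℕ) :
    ∑ u : Fin n → Bool, subtreeProj u = 1 - shortProj n := by
  simp only [subtreeProj]
  rw [← M_sum, sum_cylInd, M_sub, M_one, shortProj]

/-- The block diagonal operator with the corners of the operators `b u` in the subtrees of
level `n`. -/
noncomputable def blockSum {n : ℕ} (b : (Fin n → Bool) → BdOp Vertex) : BdOp Vertex :=
  ∑ u, subtreeProj u * b u * subtreeProj u

theorem norm_sq_sum_subtreeProj {n : ℕ} (y : (Fin n → Bool) → Ell2 Vertex) :
    ‖∑ u, subtreeProj u (y u)‖ ^ 2 = ∑ u, ‖subtreeProj u (y u)‖ ^ 2 := by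
  have h (u u' : Fin n → Bool) (x z : Ell2 Vertex) (hne : u ≠ u') :
      inner ℂ (subtreeProj u x) (subtreeProj u' z) = 0 := by
    rw [← ContinuousLinearMap.adjoint_inner_right, ← ContinuousLinearMap.star_eq_adjoint,
      star_subtreeProj, ← mul_apply_eq_comp, subtreeProj_mul_of_ne hne, zero_apply,
      inner_zero_right]
  rw [← inner_self_eq_norm_sq (𝕜 := ℂ), sum_inner, map_sum]
  refine Finset.sum_congr rfl fun u _ => ?_
  rw [inner_sum, Finset.sum_eq_single u (fun u' _ hne => h _ _ _ _ hne.symm) (by simp),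
    inner_self_eq_norm_sq]

theorem norm_blockSum_le {n : ℕ} {b : (Fin n → Bool) → BdOp Vertex} {C : ℝ} (hC : 0 ≤ C)
    (h : ∀ u, ‖b u‖ ≤ C) : ‖blockSum b‖ ≤ C := by
  have hE (u : Fin n → Bool) : ‖subtreeProj u‖ ≤ 1 := by
    refine norm_M_le zero_le_one fun v => ?_
    rw [cylInd_apply]
    split_ifs <;> simp
  refine ContinuousLinearMap.opNorm_le_bound _ hC fun f => ?_
  refine le_of_sq_le_sq ?_ (by positivity)
  have h1 : blockSum b f = ∑ u, subtreeProj u (b u (subtreeProj u f)) := by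
    simp [blockSum, sum_apply, mul_apply_eq_comp]
  have h2 (u : Fin n → Bool) :
      ‖subtreeProj u (b u (subtreeProj u f))‖ ^ 2 ≤ C ^ 2 * ‖subtreeProj u f‖ ^ 2 := by
    rw [← mul_pow]
    gcongr
    calc _ ≤ 1 * ‖b u (subtreeProj u f)‖ := ContinuousLinearMap.le_of_opNorm_le _ (hE u) _
      _ ≤ C * ‖subtreeProj u f‖ := by
        rw [one_mul]
        exact ContinuousLinearMap.le_of_opNorm_le _ (h u) _
  have h3 : ∑ u : Fin n → Bool, ‖subtreeProj u f‖ ^ 2 ≤ ‖f‖ ^ 2 := by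
    rw [← norm_sq_sum_subtreeProj fun _ => f, ← sum_apply, sum_subtreeProj]
    gcongr
    simpa using ContinuousLinearMap.le_of_opNorm_le _ (norm_one_sub_shortProj_le n) f
  rw [h1, norm_sq_sum_subtreeProj, mul_pow]
  calc _ ≤ ∑ u, C ^ 2 * ‖subtreeProj u f‖ ^ 2 := Finset.sum_le_sum fun u _ => h2 u
    _ = C ^ 2 * ∑ u, ‖subtreeProj u f‖ ^ 2 := by rw [Finset.mul_sum]
    _ ≤ _ := by gcongr

theorem star_blockSum {n : ℕ} (b : (Fin n → Bool) → BdOp Vertex) :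
    star (blockSum b) = blockSum fun u => star (b u) := by
  simp only [blockSum, star_sum, star_mul, star_subtreeProj, mul_assoc]

/-! ### Commutation modulo compact operators -/

/-- The operators which commute with a self-adjoint operator `e` up to a compact operator. -/
noncomputable def essCommutant (e : BdOp Vertex) (he : star e = e) :
    StarSubalgebra ℂ (BdOp Vertex) where
  carrier := {b | IsCompactOperator (e * b - b * e)}
  mul_mem' {b c} hb hc := by
    have h : e * (b * c) - b * c * e = (e * b - b * e) * c + b * (e * c - c * e) := by noncomm_ring
    change IsCompactOperator (e * (b * c) - b * c * e)
    rw [h]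
    exact (IsCompactOperator.comp_clm (f := (e * b - b * e : BdOp Vertex)) hb c).add
      (IsCompactOperator.clm_comp (f := (e * c - c * e : BdOp Vertex)) hc b)
  add_mem' {b c} hb hc := by
    have h : e * (b + c) - (b + c) * e = (e * b - b * e) + (e * c - c * e) := by noncomm_ring
    change IsCompactOperator (e * (b + c) - (b + c) * e)
    rw [h]
    exact IsCompactOperator.add (f := (e * b - b * e : BdOp Vertex)) hb hc
  algebraMap_mem' r := by
    change IsCompactOperator (e * algebraMap ℂ (BdOp Vertex) r - algebraMap ℂ (BdOp Vertex) r * e : BdOp Vertex)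
    rw [Algebra.commutes, sub_self]
    exact isCompactOperator_zero
  star_mem' {b} hb := by
    have h : e * star b - star b * e = -star (e * b - b * e) := by
      rw [star_sub, star_mul, star_mul, he]
      abel
    change IsCompactOperator (e * star b - star b * e)
    rw [h]
    exact (isCompactOperator_star hb).neg

theorem isClosed_essCommutant (e : BdOp Vertex) (he : star e = e) :
    IsClosed (essCommutant e he : Set (BdOp Vertex)) :=
  isClosed_setOfPred_isCompactOperator.preimage (f := fun b : BdOp Vertex => e * b - b * e)
    (by fun_prop)

theorem vertex_append_mem_cyl_iff {n : ℕ} (u : Fin n → Bool) (w : Vertex) (b : Bool)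
    (h : n ≤ w.length) : vertex (w ++ [b]) ∈ cyl u ↔ vertex w ∈ cyl u := by
  refine forall_congr' fun i => ?_
  change (w ++ [b])[(i : ℕ)]? = _ ↔ w[(i : ℕ)]? = _
  rw [List.getElem?_append_left (i.2.trans_le h)]

/-- The commutator of `L` with a subtree projection has its range in the functions supported on the
words of length at most `n`, since a long word lies in the subtree of `u` if and only if its parent does. -/
theorem L_mem_essCommutant {n : ℕ} (u : Fin n → Bool) :
    L ∈ essCommutant (subtreeProj u) (star_subtreeProj u) := by
  have h : subtreeProj u * L - L * subtreeProj u =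
      shortProj (n + 1) * (subtreeProj u * L - L * subtreeProj u) := by
    ext f v
    rw [mul_apply_eq_comp, shortProj_apply]
    split_ifs with hv
    · rfl
    · rcases List.eq_nil_or_concat v with rfl | ⟨w, b, rfl⟩
      · simp at hv
      · rw [List.concat_eq_append] at hv ⊢
        have hw : n ≤ w.length := by simp at hv; omega
        simp only [sub_apply, mul_apply_eq_comp, lp.coeFn_sub, Pi.sub_apply, subtreeProj, M_apply,
          L_apply, lp.coeFn_smul, Pi.smul_apply, S_apply_append, cylInd_apply]
        have hiff := vertex_append_mem_cyl_iff u w b hw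
        by_cases hu : vertex w ∈ cyl u
        · simp [hu, hiff.2 hu]
        · simp [hu, mt hiff.1 hu]
  change IsCompactOperator (subtreeProj u * L - L * subtreeProj u)
  rw [h]
  exact (isCompactOperator_shortProj _).comp_clm _

theorem isCompactOperator_commutator {n : ℕ} (u : Fin n → Bool) (b : CStarL) :
    IsCompactOperator (subtreeProj u * CStarGen.incl L b - CStarGen.incl L b * subtreeProj u) :=
  StarAlgebra.elemental.le_of_mem (isClosed_essCommutant _ (star_subtreeProj u))
    (L_mem_essCommutant u) (CStarGen.incl_mem L b)

/-! ### The block sum of a `C*(L)`-valued function on the boundary -/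

/-- The block diagonal operator whose block in the subtree of a word `u` of length `n` is the value
of `g` at a point of the boundary below `u`. -/
noncomputable def sample (n : ℕ) (g : C(K, CStarL)) : BdOp Vertex :=
  blockSum fun u : Fin n → Bool => CStarGen.incl L (g (basePoint u))

theorem sample_add (n : ℕ) (g h : C(K, CStarL)) : sample n (g + h) = sample n g + sample n h := by
  simp only [sample, blockSum, ContinuousMap.add_apply, map_add, mul_add, add_mul,
    Finset.sum_add_distrib]

theorem sample_sub (n : ℕ) (g h : C(K, CStarL)) : sample n (g - h) = sample n g - sample n h :=
  map_sub (AddMonoidHom.mk' (sample n) (sample_add n)) g h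

theorem sample_star (n : ℕ) (g : C(K, CStarL)) : sample n (star g) = star (sample n g) := by
  rw [sample, sample, star_blockSum]
  simp only [ContinuousMap.star_apply, map_star]

theorem norm_sample_le (n : ℕ) (g : C(K, CStarL)) : ‖sample n g‖ ≤ ‖g‖ :=
  norm_blockSum_le (norm_nonneg g) fun u => g.norm_coe_le_norm (basePoint u)

theorem isCompactOperator_finset_sum {α : Type*} {s : Finset α} {k : α → BdOp Vertex}
    (h : ∀ i ∈ s, IsCompactOperator (k i)) : IsCompactOperator (∑ i ∈ s, k i : BdOp Vertex) :=
  Submodule.sum_mem (compactOperator (RingHom.id ℂ) (Ell2 Vertex) (Ell2 Vertex)) h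

theorem isCompactOperator_sample_mul (n : ℕ) (g h : C(K, CStarL)) :
    IsCompactOperator (sample n g * sample n h - sample n (g * h) : BdOp Vertex) := by
  have key : sample n g * sample n h - sample n (g * h) = ∑ u : Fin n → Bool,
      subtreeProj u * CStarGen.incl L (g (basePoint u)) *
        ((subtreeProj u * CStarGen.incl L (h (basePoint u)) -
          CStarGen.incl L (h (basePoint u)) * subtreeProj u) * subtreeProj u) := by
    rw [sample, sample, sample, blockSum, blockSum, blockSum, Finset.sum_mul,
      ← Finset.sum_sub_distrib]
    refine Finset.sum_congr rfl fun u _ => ?_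
    set e := subtreeProj u with he
    have hee : e * e = e := subtreeProj_mul_self u
    rw [Finset.mul_sum, Finset.sum_eq_single u]
    · rw [ContinuousMap.mul_apply, map_mul, ← he]
      set b := CStarGen.incl L (g (basePoint u))
      set c := CStarGen.incl L (h (basePoint u))
      calc e * b * e * (e * c * e) - e * (b * c) * e
          = e * b * (e * e) * c * e - e * b * c * e := by noncomm_ring
        _ = e * b * e * c * e - e * b * c * (e * e) := by rw [hee]
        _ = _ := by noncomm_ring
    · intro u' _ hne
      have h0 : e * subtreeProj u' = 0 := subtreeProj_mul_of_ne hne.symm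
      rw [mul_assoc (e * _) e, ← mul_assoc e, ← mul_assoc e, h0]
      simp
    · simp
  rw [key]
  refine isCompactOperator_finset_sum fun u _ => ?_
  exact IsCompactOperator.clm_comp ((isCompactOperator_commutator u _).comp_clm (subtreeProj u))
    (subtreeProj u * CStarGen.incl L (g (basePoint u)))

/-! ### Symbols -/

/-- `a` has the symbol `g` if the distances of `a - sample n g` to the compact operators tend
to `0`. -/
def HasSymbol (a : BdOp Vertex) (g : C(K, CStarL)) : Prop :=
  ∀ ε : ℝ, 0 < ε → ∃ N, ∀ n, N ≤ n → ∃ k : BdOp Vertex, IsCompactOperator k ∧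
    ‖a - sample n g - k‖ ≤ ε

namespace HasSymbol

variable {a b : BdOp Vertex} {g h : C(K, CStarL)}

theorem add (ha : HasSymbol a g) (hb : HasSymbol b h) : HasSymbol (a + b) (g + h) := by
  intro ε hε
  obtain ⟨N₁, h₁⟩ := ha (ε / 2) (half_pos hε)
  obtain ⟨N₂, h₂⟩ := hb (ε / 2) (half_pos hε)
  refine ⟨max N₁ N₂, fun n hn => ?_⟩
  obtain ⟨k₁, hk₁, hn₁⟩ := h₁ n (le_of_max_le_left hn)
  obtain ⟨k₂, hk₂, hn₂⟩ := h₂ n (le_of_max_le_right hn)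
  refine ⟨k₁ + k₂, hk₁.add hk₂, ?_⟩
  rw [sample_add]
  calc _ = ‖(a - sample n g - k₁) + (b - sample n h - k₂)‖ := by congr 1; abel
    _ ≤ ε / 2 + ε / 2 := norm_add_le_of_le hn₁ hn₂
    _ = ε := add_halves ε

theorem star (ha : HasSymbol a g) : HasSymbol (star a) (star g) := by
  intro ε hε
  obtain ⟨N, hN⟩ := ha ε hε
  refine ⟨N, fun n hn => ?_⟩
  obtain ⟨k, hk, hn⟩ := hN n hn
  refine ⟨Star.star k, isCompactOperator_star hk, ?_⟩
  rwa [sample_star, ← star_sub, ← star_sub, norm_star]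

theorem mul (ha : HasSymbol a g) (hb : HasSymbol b h) : HasSymbol (a * b) (g * h) := by
  intro ε hε
  set δ := ε / (‖a‖ + ‖h‖ + 1) with hδ
  have hδ0 : 0 < δ := by positivity
  obtain ⟨N₁, h₁⟩ := ha δ hδ0
  obtain ⟨N₂, h₂⟩ := hb δ hδ0
  refine ⟨max N₁ N₂, fun n hn => ?_⟩
  obtain ⟨k₁, hk₁, hn₁⟩ := h₁ n (le_of_max_le_left hn)
  obtain ⟨k₂, hk₂, hn₂⟩ := h₂ n (le_of_max_le_right hn)
  -- `a b - s t = a (b - t) + (a - s) t` for `s = sample n g` and `t = sample n h`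
  refine ⟨a * k₂ + k₁ * sample n h + (sample n g * sample n h - sample n (g * h)), ?_, ?_⟩
  · exact ((hk₂.clm_comp a).add (hk₁.comp_clm (sample n h))).add
      (isCompactOperator_sample_mul n g h)
  · calc _ = ‖a * (b - sample n h - k₂) + (a - sample n g - k₁) * sample n h‖ := by
          congr 1; noncomm_ring
      _ ≤ ‖a‖ * δ + δ * ‖h‖ := norm_add_le_of_le
          ((norm_mul_le _ _).trans (by gcongr))
          ((norm_mul_le _ _).trans (by gcongr; exact norm_sample_le n h))
      _ ≤ (‖a‖ + ‖h‖ + 1) * δ := by nlinarith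
      _ = ε := mul_div_cancel₀ ε (by positivity)

theorem of_isCompactOperator (ha : IsCompactOperator a) : HasSymbol a 0 := by
  intro ε hε
  refine ⟨0, fun n _ => ⟨a, ha, ?_⟩⟩
  have : sample n 0 = 0 := map_zero (AddMonoidHom.mk' (sample n) (sample_add n))
  rw [this, sub_zero, sub_self, norm_zero]
  exact hε.le

theorem exists_norm_sub_le (ha : HasSymbol a g) {ε : ℝ} (hε : 0 < ε) :
    ∃ k : BdOp Vertex, IsCompactOperator k ∧ ‖a - k‖ ≤ ‖g‖ + ε := by
  obtain ⟨N, hN⟩ := ha ε hε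
  obtain ⟨k, hk, hk'⟩ := hN N le_rfl
  refine ⟨k, hk, ?_⟩
  calc _ = ‖sample N g + (a - sample N g - k)‖ := by congr 1; abel
    _ ≤ ‖g‖ + ε := norm_add_le_of_le (norm_sample_le N g) hk'

theorem isCompactOperator (ha : HasSymbol a 0) : IsCompactOperator a := by
  refine isClosed_setOfPred_isCompactOperator.closure_subset
    (Metric.mem_closure_iff.2 fun ε hε => ?_)
  obtain ⟨k, hk, hk'⟩ := ha.exists_norm_sub_le (half_pos hε)
  refine ⟨k, hk, ?_⟩
  rw [norm_zero, zero_add] at hk'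
  rw [dist_eq_norm]
  linarith

end HasSymbol

/-- The compact corrections are the commutators with the subtree projections, and `b` on the words of
length less than `n`, which lie in no subtree of level `n`. -/
theorem hasSymbol_incl (b : CStarL) : HasSymbol (CStarGen.incl L b) (ContinuousMap.const K b) := by
  intro ε hε
  refine ⟨0, fun n _ => ⟨CStarGen.incl L b * shortProj n -
    ∑ u : Fin n → Bool, (subtreeProj u * CStarGen.incl L b - CStarGen.incl L b * subtreeProj u) *
      subtreeProj u, ?_, ?_⟩⟩
  · exact ((isCompactOperator_shortProj n).clm_comp (CStarGen.incl L b)).sub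
      (isCompactOperator_finset_sum fun u _ =>
        (isCompactOperator_commutator u b).comp_clm (subtreeProj u))
  · have h : sample n (ContinuousMap.const K b) = ∑ u : Fin n → Bool,
        (subtreeProj u * CStarGen.incl L b - CStarGen.incl L b * subtreeProj u) * subtreeProj u +
        CStarGen.incl L b * (1 - shortProj n) := by
      rw [← sum_subtreeProj, Finset.mul_sum, ← Finset.sum_add_distrib, sample, blockSum]
      refine Finset.sum_congr rfl fun u _ => ?_
      rw [sub_mul, mul_assoc (CStarGen.incl L b), subtreeProj_mul_self, ContinuousMap.const_apply]
      abel
    rw [h]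
    refine le_of_eq_of_le (norm_eq_zero.2 ?_) hε.le
    noncomm_ring

/-- The symbol of a multiplication operator is the scalar function given by its restriction to the
boundary. -/
theorem hasSymbol_M (f : C(T0, ℂ)) :
    HasSymbol (M f) ⟨fun x => algebraMap ℂ CStarL (f x.1),
      (continuous_algebraMap ℂ CStarL).comp (f.continuous.comp continuous_subtype_val)⟩ := by
  intro ε hε
  obtain ⟨N, hN⟩ := exists_dist_basePoint_lt f.continuous hε
  refine ⟨N, fun n hn => ?_⟩
  set p : C(T0, ℂ) := ∑ u : Fin n → Bool, f (basePoint u).1 • cylInd u with hp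
  have hs : sample n ⟨fun x => algebraMap ℂ CStarL (f x.1),
      (continuous_algebraMap ℂ CStarL).comp (f.continuous.comp continuous_subtype_val)⟩ =
      M p := by
    rw [hp, M_sum, sample, blockSum]
    refine Finset.sum_congr rfl fun u _ => ?_
    change subtreeProj u * CStarGen.incl L (algebraMap ℂ CStarL (f (basePoint u).1)) *
      subtreeProj u = _
    rw [AlgHomClass.commutes, M_smul, ← Algebra.commutes, mul_assoc, subtreeProj_mul_self,
      ← Algebra.smul_def, subtreeProj]
  refine ⟨M ((f - p) * short n), ?_, ?_⟩
  · rw [M_mul]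
    exact (isCompactOperator_shortProj n).clm_comp (M (f - p))
  · rw [hs, ← M_sub, ← M_sub]
    refine norm_M_le hε.le fun v => ?_
    rw [ContinuousMap.sub_apply, ContinuousMap.mul_apply, short_apply]
    split_ifs with h
    · simpa using hε.le
    · obtain ⟨u, hu⟩ := exists_mem_cyl h
      have hpu : p (vertex v) = f (basePoint u).1 := by
        rw [hp, ContinuousMap.sum_apply]
        exact sum_mul_cylInd_apply (fun u => f (basePoint u).1) hu
      rw [mul_zero, sub_zero, ContinuousMap.sub_apply, hpu, ← dist_eq_norm]
      exact (hN n hn u _ hu).le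

/-! ### Deep chains and the norm of the symbol -/

/-- Powers of `L` do not leave the subtree below `v`. -/
theorem L_pow_siblingDiff_apply_eq_zero (v : Vertex) (k : ℕ) {w : Vertex} (h : ¬ v <+: w) :
    (L ^ k) (siblingDiff v) w = 0 := by
  induction k generalizing w with
  | zero =>
    have hb (b : Bool) : w ≠ v ++ [b] := fun e => h (e ▸ List.prefix_append v [b])
    simp only [pow_zero, one_apply_eq_self, siblingDiff, lp.coeFn_smul, lp.coeFn_sub,
      Pi.smul_apply, Pi.sub_apply, basisVec_apply, hb]
    simp
  | succ k ih =>
    rw [pow_succ', mul_apply_eq_comp, L_apply, lp.coeFn_smul, Pi.smul_apply]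
    rcases List.eq_nil_or_concat w with rfl | ⟨w, b, rfl⟩
    · rw [S_apply_nil, smul_zero]
    · rw [List.concat_eq_append] at h ⊢
      rw [S_apply_append, ih fun h' => h (h'.trans (List.prefix_append w [b])), smul_zero]

theorem M_comp_chain {f : C(T0, ℂ)} {c : ℂ} {v : Vertex}
    (h : ∀ w, v <+: w → f (vertex w) = c) :
    M f ∘L (wandering_siblingDiff v).chain = c • (wandering_siblingDiff v).chain := by
  refine clm_ext_basisVec fun k => ?_
  rw [ContinuousLinearMap.comp_apply, smul_apply, Wandering.chain_basisVec]
  ext w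
  rw [M_apply, lp.coeFn_smul, Pi.smul_apply, smul_eq_mul]
  by_cases hw : v <+: w
  · rw [h w hw]
  · rw [L_pow_siblingDiff_apply_eq_zero v k hw, mul_zero, mul_zero]

theorem shortProj_comp_chain {n : ℕ} {v : Vertex} (h : n ≤ v.length) :
    shortProj n ∘L (wandering_siblingDiff v).chain = 0 := by
  rw [shortProj, M_comp_chain (c := 0) fun w hw => ?_, zero_smul]
  rw [short_vertex, if_neg]
  have := hw.length_le
  omega

theorem vertex_mem_cyl_of_prefix {n : ℕ} {u : Fin n → Bool} {w : Vertex}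
    (h : List.ofFn u <+: w) : vertex w ∈ cyl u := by
  intro i
  obtain ⟨s, rfl⟩ := h
  change (List.ofFn u ++ s)[(i : ℕ)]? = some (u i)
  rw [List.getElem?_append_left (by simp), List.getElem?_ofFn, dif_pos i.2]

theorem blockSum_comp_chain {n : ℕ} (b : (Fin n → Bool) → CStarL) {u : Fin n → Bool} {v : Vertex}
    (hv : List.ofFn u <+: v) :
    blockSum (fun u => CStarGen.incl L (b u)) ∘L (wandering_siblingDiff v).chain =
      (wandering_siblingDiff v).chain ∘L chainHom (b u) := by
  have hE (u' : Fin n → Bool) : subtreeProj u' ∘L (wandering_siblingDiff v).chain =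
      (if u' = u then 1 else 0 : ℂ) • (wandering_siblingDiff v).chain := by
    refine M_comp_chain fun w hw => ?_
    have hwu := vertex_mem_cyl_of_prefix (hv.trans hw)
    rw [cylInd_apply]
    by_cases h : u' = u
    · rw [if_pos h, if_pos (h ▸ hwu)]
    · rw [if_neg h, if_neg fun h' => h (eq_of_mem_cyl h' hwu)]
  have hsummand (u' : Fin n → Bool) :
      (subtreeProj u' * CStarGen.incl L (b u') * subtreeProj u') ∘L
        (wandering_siblingDiff v).chain = (if u' = u then 1 else 0 : ℂ) •
          (wandering_siblingDiff v).chain ∘L chainHom (b u') := by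
    rw [ContinuousLinearMap.mul_def, ContinuousLinearMap.mul_def, ContinuousLinearMap.comp_assoc,
      hE, ContinuousLinearMap.comp_smul, ContinuousLinearMap.comp_assoc, comp_chain_eq,
      ← ContinuousLinearMap.comp_assoc, hE]
    split_ifs <;> simp
  rw [blockSum, ContinuousLinearMap.finsetSum_comp, Finset.sum_congr rfl fun u' _ => hsummand u']
  simp

/-- Deep chains in the subtree of `u` detect `b u` and are nearly annihilated by compact
operators. -/
theorem norm_le_norm_blockSum_sub {n : ℕ} (b : (Fin n → Bool) → CStarL) (u : Fin n → Bool)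
    {k : BdOp Vertex} (hk : IsCompactOperator k) :
    ‖b u‖ ≤ ‖blockSum (fun u => CStarGen.incl L (b u)) - k‖ := by
  refine le_of_forall_pos_le_add fun ε hε => ?_
  obtain ⟨N, hN⟩ := exists_norm_sub_mul_shortProj_le hk hε
  set v : Vertex := List.ofFn u ++ List.replicate N false
  set W := (wandering_siblingDiff v).chain with hW
  have hW1 : ‖W‖ ≤ 1 := Wandering.norm_chain_le _
  have hkW : ‖k ∘L W‖ ≤ ε := by
    have h0 : k ∘L W = (k - k * shortProj N) ∘L W := by
      rw [ContinuousLinearMap.sub_comp, ContinuousLinearMap.mul_def,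
        ContinuousLinearMap.comp_assoc, hW, shortProj_comp_chain (by simp [v]),
        ContinuousLinearMap.comp_zero, sub_zero]
    rw [h0]
    calc _ ≤ ‖k - k * shortProj N‖ * ‖W‖ := ContinuousLinearMap.opNorm_comp_le _ _
      _ ≤ ε * 1 := mul_le_mul (hN N le_rfl) hW1 (norm_nonneg _) hε.le
      _ = ε := mul_one ε
  rw [← norm_chainHom]
  refine ContinuousLinearMap.opNorm_le_bound _ (by positivity) fun f => ?_
  have h1 : W (chainHom (b u) f) = ((blockSum (fun u => CStarGen.incl L (b u)) - k) ∘L W) f +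
      (k ∘L W) f := by
    rw [← ContinuousLinearMap.comp_apply, ← blockSum_comp_chain b (List.prefix_append _ _)]
    simp [W, v]
  rw [← (wandering_siblingDiff v).norm_chain_apply, ← hW, h1, add_mul]
  refine norm_add_le_of_le ?_ (ContinuousLinearMap.le_of_opNorm_le _ hkW f)
  refine ContinuousLinearMap.le_of_opNorm_le _ ((ContinuousLinearMap.opNorm_comp_le _ _).trans ?_) f
  exact mul_le_of_le_one_right (norm_nonneg _) hW1

theorem HasSymbol.norm_le {a : BdOp Vertex} {g : C(K, CStarL)} (ha : HasSymbol a g)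
    {k : BdOp Vertex} (hk : IsCompactOperator k) : ‖g‖ ≤ ‖a - k‖ := by
  refine (ContinuousMap.norm_le g (norm_nonneg _)).2 fun x => le_of_forall_pos_le_add fun ε hε => ?_
  obtain ⟨N₁, h₁⟩ := ha (ε / 2) (half_pos hε)
  obtain ⟨N₂, h₂⟩ := exists_dist_basePoint_initialWord_lt g.continuous (half_pos hε)
  set n := max N₁ N₂
  obtain ⟨k', hk', hn⟩ := h₁ n (le_max_left _ _)
  have hx := h₂ n (le_max_right _ _) x
  set u := initialWord n x
  have h3 : ‖g (basePoint u)‖ ≤ ‖sample n g - (k - k')‖ :=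
    norm_le_norm_blockSum_sub (fun u => g (basePoint u)) u (hk.sub hk')
  have h4 : ‖sample n g - (k - k')‖ ≤ ‖a - k‖ + ‖a - sample n g - k'‖ := by
    calc _ = ‖(a - k) - (a - sample n g - k')‖ := by congr 1; abel
      _ ≤ _ := norm_sub_le _ _
  rw [dist_eq_norm] at hx
  linarith [norm_le_norm_add_norm_sub' (g x) (g (basePoint u))]

/-! ### The symbol homomorphism -/

/-- The graph of the symbol, as a `*`-algebra of pairs. -/
noncomputable def symbolGraph : StarSubalgebra ℂ (BdOp Vertex × C(K, CStarL)) where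
  carrier := {p | HasSymbol p.1 p.2}
  mul_mem' ha hb := HasSymbol.mul ha hb
  add_mem' ha hb := HasSymbol.add ha hb
  star_mem' ha := HasSymbol.star ha
  algebraMap_mem' r := by
    have h := hasSymbol_incl (algebraMap ℂ CStarL r)
    rw [AlgHomClass.commutes] at h
    exact h

theorem isClosed_symbolGraph : IsClosed (symbolGraph : Set (BdOp Vertex × C(K, CStarL))) := by
  refine isClosed_of_closure_subset fun p hp ε hε => ?_
  obtain ⟨q, hq, hpq⟩ := Metric.mem_closure_iff.1 hp (ε / 3) (by positivity)
  have h1 : ‖p.1 - q.1‖ < ε / 3 := by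
    rw [← dist_eq_norm]
    exact (le_max_left _ _).trans_lt hpq
  have h2 : ‖q.2 - p.2‖ < ε / 3 := by
    rw [norm_sub_rev, ← dist_eq_norm]
    exact (le_max_right _ _).trans_lt hpq
  obtain ⟨N, hN⟩ := hq (ε / 3) (by positivity)
  refine ⟨N, fun n hn => ?_⟩
  obtain ⟨k, hk, hk'⟩ := hN n hn
  refine ⟨k, hk, ?_⟩
  calc _ = ‖(p.1 - q.1) + (q.1 - sample n q.2 - k) + sample n (q.2 - p.2)‖ := by
        rw [sample_sub]; congr 1; abel
    _ ≤ ε / 3 + ε / 3 + ε / 3 := norm_add_le_of_le (norm_add_le_of_le h1.le hk')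
        ((norm_sample_le n _).trans h2.le)
    _ = ε := by ring

instance : CompleteSpace symbolGraph := isClosed_symbolGraph.completeSpace_coe

/-- The first projection of the graph. -/
noncomputable def graphFst : symbolGraph →⋆ₐ[ℂ] BdOp Vertex :=
  (StarAlgHom.fst ℂ _ _).comp symbolGraph.subtype

/-- The second projection of the graph. -/
noncomputable def graphSnd : symbolGraph →⋆ₐ[ℂ] C(K, CStarL) :=
  (StarAlgHom.snd ℂ _ _).comp symbolGraph.subtype

theorem hasSymbol_graph (p : symbolGraph) : HasSymbol (graphFst p) (graphSnd p) := p.2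

/-- An operator and its symbol, as an element of the graph. -/
noncomputable def HasSymbol.toGraph {a : BdOp Vertex} {g : C(K, CStarL)} (h : HasSymbol a g) :
    symbolGraph := ⟨(a, g), h⟩

theorem HasSymbol.graphFst_toGraph {a : BdOp Vertex} {g : C(K, CStarL)} (h : HasSymbol a g) :
    graphFst h.toGraph = a := rfl

theorem HasSymbol.graphSnd_toGraph {a : BdOp Vertex} {g : C(K, CStarL)} (h : HasSymbol a g) :
    graphSnd h.toGraph = g := rfl

theorem isometry_graphFst : Isometry graphFst := by
  refine AddMonoidHomClass.isometry_of_norm graphFst fun p => ?_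
  have h := (hasSymbol_graph p).norm_le (k := 0) isCompactOperator_zero
  have h' : ‖graphSnd p‖ ≤ ‖graphFst p‖ := by simpa using h
  exact (max_eq_left h').symm

/-- Every operator of `A` has a symbol, and only these. -/
theorem range_graphFst : graphFst.range = A := by
  refine le_antisymm ?_ (StarSubalgebra.topologicalClosure_minimal
    (StarAlgebra.adjoin_le ?_) isometry_graphFst.isClosedEmbedding.isClosed_range)
  · rintro _ ⟨p, rfl⟩
    have hL : StarAlgebra.elemental ℂ L ≤ A := StarAlgebra.elemental.le_of_mem isClosed_A L_mem_A
    refine isClosed_A.closure_subset (Metric.mem_closure_iff.2 fun ε hε => ?_)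
    obtain ⟨N, hN⟩ := hasSymbol_graph p (ε / 2) (half_pos hε)
    obtain ⟨k, hk, hk'⟩ := hN N le_rfl
    refine ⟨sample N (graphSnd p) + k, A.add_mem (A.sum_mem fun u _ => A.mul_mem
      (A.mul_mem (M_mem_A _) (hL (CStarGen.incl_mem L _))) (M_mem_A _))
      (mem_A_of_isCompactOperator hk), ?_⟩
    rw [dist_eq_norm, ← sub_sub]
    exact hk'.trans_lt (half_lt_self hε)
  · rintro _ (rfl | ⟨f, rfl⟩)
    · rw [S_eq_smul_L]
      exact graphFst.range.smul_mem
        ⟨_, (hasSymbol_incl (CStarGen.gen L)).graphFst_toGraph⟩ _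
    · exact ⟨_, (hasSymbol_M f).graphFst_toGraph⟩

/-- The locally constant function which has on each cylinder of level `n` the value of `g` at the
base point of this cylinder. -/
noncomputable def locConst {B : Type} [CStarAlgebra B] (n : ℕ) (g : C(K, B)) : C(K, B) :=
  tensorToFun B K (∑ u : Fin n → Bool,
    g (basePoint u) ⊗ₜ (cylInd u).comp ⟨Subtype.val, continuous_subtype_val⟩)

theorem locConst_apply {B : Type} [CStarAlgebra B] (n : ℕ) (g : C(K, B)) (x : K) :
    locConst n g x = g (basePoint (initialWord n x)) := by
  rw [locConst, map_sum, ContinuousMap.sum_apply, Finset.sum_eq_single (initialWord n x)]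
  · rw [tensorToFun_tmul, ContinuousMap.comp_apply]
    change cylInd _ x.1 • _ = _
    rw [cylInd_apply, if_pos (mem_cyl_initialWord n x), one_smul]
  · intro u _ hu
    rw [tensorToFun_tmul, ContinuousMap.comp_apply]
    change cylInd _ x.1 • _ = _
    rw [cylInd_apply, if_neg fun h => hu (eq_of_mem_cyl h (mem_cyl_initialWord n x)), zero_smul]
  · simp

theorem exists_dist_locConst_lt {B : Type} [CStarAlgebra B] (g : C(K, B)) {ε : ℝ} (hε : 0 < ε) :
    ∃ n, dist g (locConst n g) < ε := by
  obtain ⟨N, hN⟩ := exists_dist_basePoint_initialWord_lt g.continuous hε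
  refine ⟨N, (ContinuousMap.dist_lt_iff hε).2 fun x => ?_⟩
  rw [locConst_apply]
  exact hN N le_rfl x

theorem CStarTensor_boundary_eq_top (B : Type) [CStarAlgebra B] : CStarTensor B K = ⊤ := by
  refine top_le_iff.1 fun g _ => Metric.mem_closure_iff.2 fun ε hε => ?_
  obtain ⟨n, hn⟩ := exists_dist_locConst_lt g hε
  exact ⟨_, ⟨_, rfl⟩, hn⟩

/-- The operator `sample n g` has the locally constant symbol `locConst n g`. -/
theorem hasSymbol_sample (n : ℕ) (g : C(K, CStarL)) : HasSymbol (sample n g) (locConst n g) := by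
  let E (u : Fin n → Bool) : symbolGraph := (hasSymbol_M (cylInd u)).toGraph
  let b (u : Fin n → Bool) : symbolGraph := (hasSymbol_incl (g (basePoint u))).toGraph
  have h := hasSymbol_graph (∑ u, E u * b u * E u)
  simp only [map_sum, map_mul, E, b, HasSymbol.graphFst_toGraph, HasSymbol.graphSnd_toGraph] at h
  refine (congrArg₂ HasSymbol rfl ?_).mpr h
  rw [locConst, map_sum]
  refine Finset.sum_congr rfl fun u _ => ?_
  ext1 x
  rw [tensorToFun_tmul]
  change cylInd u x.1 • g (basePoint u) = algebraMap ℂ CStarL (cylInd u x.1) * g (basePoint u) *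
    algebraMap ℂ CStarL (cylInd u x.1)
  rw [cylInd_apply]
  split_ifs <;> simp

/-- Surjectivity: the range is dense, and it is closed because every symbol has a preimage of norm
at most twice its own, obtained by subtracting a compact operator. -/
theorem graphSnd_surjective : Function.Surjective graphSnd := by
  let F : NormedAddGroupHom symbolGraph C(K, CStarL) :=
    AddMonoidHom.mkNormedAddGroupHom (graphSnd : symbolGraph →+ C(K, CStarL)) 1 fun p => by
      rw [one_mul]
      exact le_max_right _ _
  have hF : F.SurjectiveOnWith F.range 2 := by
    rintro _ ⟨p, rfl⟩
    change ∃ q, graphSnd q = graphSnd p ∧ ‖q‖ ≤ 2 * ‖graphSnd p‖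
    by_cases h0 : graphSnd p = 0
    · exact ⟨0, by rw [h0, map_zero], by simp⟩
    · -- a compact correction of the first entry leaves the symbol unchanged
      have hpos : 0 < ‖graphSnd p‖ := norm_pos_iff.2 h0
      obtain ⟨k, hk, hle⟩ := (hasSymbol_graph p).exists_norm_sub_le hpos
      refine ⟨p - (HasSymbol.of_isCompactOperator hk).toGraph, ?_, ?_⟩
      · rw [map_sub, HasSymbol.graphSnd_toGraph, sub_zero]
      · rw [← isometry_graphFst.norm_map_of_map_zero (map_zero _), map_sub,
          HasSymbol.graphFst_toGraph, two_mul]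
        exact hle
  have hclosed := controlled_closure_of_complete two_pos one_pos hF
  intro g
  have hg : g ∈ F.range.topologicalClosure := by
    refine Metric.mem_closure_iff.2 fun ε hε => ?_
    obtain ⟨n, hn⟩ := exists_dist_locConst_lt g hε
    exact ⟨_, ⟨(hasSymbol_sample n g).toGraph, rfl⟩, hn⟩
  obtain ⟨p, hp, -⟩ := hclosed g hg
  exact ⟨p, hp⟩

/-- The graph of the symbol projects isomorphically onto `A`. -/
noncomputable def graphEquiv : symbolGraph ≃⋆ₐ[ℂ] A :=
  StarAlgEquiv.ofBijective (graphFst.codRestrict A fun p => range_graphFst.le ⟨p, rfl⟩)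
    ⟨fun p q h => isometry_graphFst.injective (congrArg Subtype.val h), fun a => by
      obtain ⟨p, hp⟩ : (a : BdOp Vertex) ∈ graphFst.range := range_graphFst.ge a.2
      exact ⟨p, Subtype.ext hp⟩⟩

/-- The symbol, as a `*`-homomorphism on `A`. -/
noncomputable def symbolHom : A →⋆ₐ[ℂ] C(K, CStarL) :=
  graphSnd.comp (graphEquiv.symm : A →⋆ₐ[ℂ] symbolGraph)

theorem hasSymbol_symbolHom (a : A) : HasSymbol (a : BdOp Vertex) (symbolHom a) := by
  have h := hasSymbol_graph (graphEquiv.symm a)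
  have ha : graphFst (graphEquiv.symm a) = a :=
    congrArg Subtype.val (graphEquiv.apply_symm_apply a)
  rwa [ha] at h

theorem symbolHom_surjective : Function.Surjective symbolHom :=
  graphSnd_surjective.comp graphEquiv.symm.surjective

theorem symbolHom_eq_zero_iff (a : A) : symbolHom a = 0 ↔ a ∈ compactIdeal A := by
  refine ⟨fun h => ?_, fun h => ?_⟩
  · exact (h ▸ hasSymbol_symbolHom a).isCompactOperator
  · have := (hasSymbol_symbolHom a).norm_le h
    rwa [sub_self, norm_zero, norm_le_zero_iff] at this

/-- The homomorphism induced by the symbol on the quotient by the compact operators. -/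
noncomputable def quotientHom : (A ⧸ compactIdeal A) →+* C(K, CStarL) :=
  Ideal.Quotient.lift (compactIdeal A) (symbolHom : A →+* C(K, CStarL))
    fun a ha => (symbolHom_eq_zero_iff a).2 ha

theorem quotientHom_mk (a : A) : quotientHom (Ideal.Quotient.mk _ a) = symbolHom a := rfl

theorem quotientHom_bijective : Function.Bijective quotientHom := by
  refine ⟨(injective_iff_map_eq_zero quotientHom.toAddMonoidHom).2 fun x hx => ?_, fun g => ?_⟩
  · obtain ⟨a, rfl⟩ := Ideal.Quotient.mk_surjective x
    exact Ideal.Quotient.eq_zero_iff_mem.2 ((symbolHom_eq_zero_iff a).1 hx)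
  · obtain ⟨a, rfl⟩ := symbolHom_surjective g
    exact ⟨Ideal.Quotient.mk _ a, quotientHom_mk a⟩

theorem quotientHom_star (x : A ⧸ compactIdeal A) : quotientHom (star x) = star (quotientHom x) := by
  obtain ⟨a, rfl⟩ := Ideal.Quotient.mk_surjective x
  have h : star (Ideal.Quotient.mk (compactIdeal A) a) = Ideal.Quotient.mk _ (star a) := rfl
  rw [h, quotientHom_mk, quotientHom_mk, map_star]

theorem quotientHom_smul (r : ℂ) (x : A ⧸ compactIdeal A) :
    quotientHom (r • x) = r • quotientHom x := by
  obtain ⟨a, rfl⟩ := Ideal.Quotient.mk_surjective x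
  have h : r • Ideal.Quotient.mk (compactIdeal A) a = Ideal.Quotient.mk _ (r • a) := rfl
  rw [h, quotientHom_mk, quotientHom_mk, map_smul]

/-- The symbol induces an isomorphism of `A / 𝒦` onto the algebra of continuous functions from the
boundary to `C*(L)`. -/
noncomputable def quotientEquiv : (A ⧸ compactIdeal A) ≃⋆ₐ[ℂ] C(K, CStarL) where
  __ := RingEquiv.ofBijective quotientHom quotientHom_bijective
  map_star' := quotientHom_star
  map_smul' := quotientHom_smul

/-! ### Coefficients in isomorphic algebras -/

/-- Pointwise application of a `*`-isomorphism to continuous functions. -/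
noncomputable def mapCoeff {B C : Type} [CStarAlgebra B] [CStarAlgebra C] (X : Type)
    [TopologicalSpace X] [CompactSpace X] (e : B ≃⋆ₐ[ℂ] C) : C(X, B) ≃⋆ₐ[ℂ] C(X, C) where
  toFun f := ⟨fun x => e (f x), (NonUnitalStarAlgHom.isometry e e.injective).continuous.comp
    f.continuous⟩
  invFun f := ⟨fun x => e.symm (f x),
    (NonUnitalStarAlgHom.isometry e.symm e.symm.injective).continuous.comp f.continuous⟩
  left_inv f := by ext x; exact e.symm_apply_apply (f x)
  right_inv f := by ext x; exact e.apply_symm_apply (f x)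
  map_mul' f g := by ext x; exact map_mul e (f x) (g x)
  map_add' f g := by ext x; exact map_add e (f x) (g x)
  map_star' f := by ext x; exact map_star e (f x)
  map_smul' r f := by ext x; exact map_smul e r (f x)

/-- Over the boundary, the tensor product `B ⊗ C(K)` consists of all continuous functions. -/
noncomputable def tensorEquiv (B : Type) [CStarAlgebra B] : C(K, B) ≃⋆ₐ[ℂ] CStarTensor B K where
  toFun g := ⟨g, CStarTensor_boundary_eq_top B ▸ trivial⟩
  invFun g := g
  left_inv _ := rfl
  right_inv _ := rfl
  map_mul' _ _ := rfl
  map_add' _ _ := rfl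
  map_star' _ := rfl
  map_smul' _ _ := rfl

end TreeShift

theorem proposition3p2 :
    (∀ T : TreeShift.BdOp TreeShift.Vertex, IsCompactOperator T → T ∈ TreeShift.A) ∧
    Nonempty ((TreeShift.A ⧸ TreeShift.compactIdeal TreeShift.A) ≃⋆ₐ[ℂ]
      TreeShift.CStarTensor TreeShift.CStarL TreeShift.K) ∧
    Nonempty (TreeShift.CStarL ≃⋆ₐ[ℂ] TreeShift.CStarV) ∧
    Nonempty ((TreeShift.A ⧸ TreeShift.compactIdeal TreeShift.A) ≃⋆ₐ[ℂ]
      TreeShift.CStarTensor TreeShift.CStarV TreeShift.K) :=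
  ⟨fun _ hT => TreeShift.mem_A_of_isCompactOperator hT,
    ⟨TreeShift.quotientEquiv.trans (TreeShift.tensorEquiv _)⟩,
    ⟨TreeShift.toeplitzEquiv⟩,
    ⟨(TreeShift.quotientEquiv.trans (TreeShift.mapCoeff _ TreeShift.toeplitzEquiv)).trans
      (TreeShift.tensorEquiv _)⟩⟩
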